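/- Let $p\ge 0$ and let $X$ (event time), $C$ (censoring time) and $Z\in\mathbb R^p$ (covariates) be random variables on a probability space such that $X$ and $C$ are conditionally independent given $Z$. Assume the Cox model: for almost every $z$, given $Z=z$, $X$ is a nonnegative random variable with an absolutely continuous distribution function $F(\cdot\mid z)$ and hazard $\lambda_0(x)e^{\beta_0'z}$, that is, with a density $f(\cdot\mid z)$ satisfying $f(x\mid z)=\lambda_0(x)e^{\beta_0'z}\,(1-F(x\mid z))$ for $x\ge 0$, where $\lambda_0$ is nonnegative on $[0,\infty)$ and measurable and $\beta_0\in\mathbb R^p$; and for almost every $z$, given $Z=z$, $C$ is nonnegative with an absolutely continuous distribution. Let $T=\min(X,C)$ and $\Delta=\mathbf 1\{X\le C\}$, let $F$, $G$, $H$ be the distribution functions of $X$, $C$, $T$, and let $\tau_F,\tau_G,\tau_H$ be the right end points of their supports. Assume (A1) $\tau_H=\tau_G<\tau_F\le\infty$; (A2) there is $\varepsilon>0$ with $\sup_{|\beta-\beta_0|\le\varepsilon}\mathbb E\big[|Z|^2e^{2\beta'Z}\big]<\infty$; and that the baseline hazard is identifiable, in the following sense: if $\mathbb P(\Delta=1)>0$,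 then there is no $c\in\mathbb R^p$ with $c'Z=1$ almost surely on $\{\Delta=1\}$. Let $(T_i,\Delta_i,Z_i)$, $i\ge 1$, be i.i.d. copies of $(T,\Delta,Z)$. For each $n$ let $\hat\beta_n$ be a maximum partial likelihood estimator, i.e. almost surely $\hat\beta_n$ maximizes $$\beta\mapsto\prod_{i\le n:\ \Delta_i=1}\frac{e^{\beta'Z_i}}{\sum_{j=1}^n\mathbf 1\{T_j\ge T_i\}e^{\beta'Z_j}}$$ over $\mathbb R^p$ whenever a maximizer exists (and is arbitrary otherwise). Let $$\Lambda_n(x)=\sum_{s\le x}\frac{d_s}{\sum_{j=1}^n\mathbf 1\{T_j\ge s\}e^{\hat\beta_n'Z_j}}$$ be the Breslow estimator, where the sum is over the distinct observed event times $s\le x$ (the values $T_i$, $i\le n$, with $\Delta_i=1$) and $d_s=\#\{i\le n:\Delta_i=1,\ T_i=s\}$. Put $F_n(x)=1-e^{-\Lambda_n(x)}$, $\Lambda_0(x)=\int_0^x\lambda_0(u)\,du$ and $F_0(x)=1-e^{-\Lambda_0(x)}$. Then for every $0<M<\tau_H$, $$\sup_{x\in[0,M]}|F_n(x)-F_0(x)|\longrightarrow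 0\qquad\text{as }n\to\infty,\text{ almost surely.}$$ -/

import Mathlib

open MeasureTheory ProbabilityTheory Filter Set
open scoped Topology ENNReal

namespace CoxBreslow

noncomputable section

/-- The covariate space `ℝ^p` with its Euclidean norm and inner product. -/
abbrev Cov (p : ℕ) : Type := EuclideanSpace ℝ (Fin p)

/-! ### The model -/

/-- The probability law `ν` on `[0, ∞)` has hazard function `h`: it is absolutely continuous with
a density `f` such that `f x = h x * (1 - F x)`, where `F x = ν (-∞, x]`, that is,
`h = f / (1 - F)` wherever `F < 1` (and `f = 0` where `F = 1`). -/
def HasHazard (ν : Measure ℝ) (h : ℝ → ℝ) : Prop :=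
  ν = (volume.restrict (Ici (0 : ℝ))).withDensity
    (fun x => ENNReal.ofReal (h x) * ν (Ioi x))

/-- The Cox proportional hazards model for a generic event time `X`, censoring time `C` and
covariate vector `Z`, with baseline hazard `lam0` and regression coefficients `beta0`. -/
structure IsCoxModel {p : ℕ} {Ω : Type*} [MeasurableSpace Ω] (P : Measure Ω)
    [IsProbabilityMeasure P] (X C : Ω → ℝ) (Z : Ω → Cov p) (lam0 : ℝ → ℝ) (beta0 : Cov p) :
    Prop where
  measurable_X : Measurable X
  measurable_C : Measurable C
  measurable_Z : Measurable Z
  measurable_lam0 : Measurable lam0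
  lam0_nonneg : ∀ x, 0 ≤ x → 0 ≤ lam0 x
  /-- Given `Z = z`, the event time has hazard `lam0 x * exp (beta0' z)`. -/
  hazard : ∀ᵐ z ∂(P.map Z),
    HasHazard (condDistrib X Z P z) (fun x => lam0 x * Real.exp (inner ℝ beta0 z))
  /-- Given `Z = z`, the censoring time is nonnegative and absolutely continuous. -/
  censoring : ∀ᵐ z ∂(P.map Z),
    condDistrib C Z P z ≪ volume ∧ condDistrib C Z P z (Iio 0) = 0
  /-- `X` and `C` are conditionally independent given `Z`. -/
  condIndep : ∀ᵐ z ∂(P.map Z),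
    condDistrib (fun ω => (X ω, C ω)) Z P z = (condDistrib X Z P z).prod (condDistrib C Z P z)

/-- The (right) end point of the support of a law on the line. -/
def supportEnd (ν : Measure ℝ) : EReal := ⨆ x ∈ ν.support, (x : EReal)

/-- The end point condition `τ_H = τ_G < τ_F`, for the end points of the supports of the laws of
`T = min X C`, of `C` and of `X`. -/
def EndPointCondition {Ω : Type*} [MeasurableSpace Ω] (P : Measure Ω) (X C : Ω → ℝ) : Prop :=
  supportEnd (P.map (fun ω => min (X ω) (C ω))) = supportEnd (P.map C) ∧
    supportEnd (P.map C) < supportEnd (P.map X)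

/-- The moment condition `sup_{|β - β₀| ≤ ε} E[|Z|² exp (2 β' Z)] < ∞` for some `ε > 0`. -/
def MomentCondition {p : ℕ} {Ω : Type*} [MeasurableSpace Ω] (P : Measure Ω) (Z : Ω → Cov p)
    (beta0 : Cov p) : Prop :=
  ∃ ε : ℝ, 0 < ε ∧
    (⨆ β ∈ Metric.closedBall beta0 ε,
      ∫⁻ ω, ENNReal.ofReal (‖Z ω‖ ^ 2 * Real.exp (2 * inner ℝ β (Z ω))) ∂P) < ⊤

/-- Identifiability of the baseline hazard: unless events are never observed, no linear
combination of the covariates is almost surely equal to `1` (equivalently, to some nonzero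
constant) on the event `X ≤ C`. If `c' Z = 1` there, then `(lam0, beta0)` and
`(exp (-s) * lam0, beta0 + s c)` cannot be told apart from the observed events. -/
def BaselineIdentifiable {p : ℕ} {Ω : Type*} [MeasurableSpace Ω] (P : Measure Ω) (X C : Ω → ℝ)
    (Z : Ω → Cov p) : Prop :=
  ∀ c : Cov p, (∀ᵐ ω ∂P, X ω ≤ C ω → inner ℝ c (Z ω) = 1) → ∀ᵐ ω ∂P, ¬ X ω ≤ C ω

/-- The baseline cumulative hazard `Λ₀ x = ∫₀ˣ λ₀`. -/
def baseCumHazard (lam0 : ℝ → ℝ) (x : ℝ) : ℝ := ∫ u in (0 : ℝ)..x, lam0 u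

/-- The baseline distribution function `F₀ = 1 - exp (-Λ₀)`. -/
def baseCDF (lam0 : ℝ → ℝ) (x : ℝ) : ℝ := 1 - Real.exp (-baseCumHazard lam0 x)

/-- An i.i.d. sequence of observed triplets `(T i, Δ i, Z i)`, each distributed as
`(min X C, {X ≤ C}, Z)` for the generic variables `X`, `C`, `Z`. -/
structure IsCensoredSample {p : ℕ} {Ω Ω' : Type*} [MeasurableSpace Ω] [MeasurableSpace Ω']
    (Q : Measure Ω') (T : ℕ → Ω' → ℝ) (Δ : ℕ → Ω' → Bool) (Zs : ℕ → Ω' → Cov p)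
    (P : Measure Ω) (X C : Ω → ℝ) (Z : Ω → Cov p) : Prop where
  measurable_T : ∀ i, Measurable (T i)
  measurable_Δ : ∀ i, Measurable (Δ i)
  measurable_Zs : ∀ i, Measurable (Zs i)
  indep : iIndepFun (fun i ω => (T i ω, Δ i ω, Zs i ω)) Q
  identDistrib : ∀ i, IdentDistrib (fun ω => (T i ω, Δ i ω, Zs i ω))
    (fun ω => (min (X ω) (C ω), decide (X ω ≤ C ω), Z ω)) Q P

/-! ### The estimators, for data `t`, `d`, `z` of which the first `n` entries are used -/

/-- `∑_{j ≤ n} {T_j ≥ x} exp (β' Z_j)`. -/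
def riskSum {p : ℕ} (t : ℕ → ℝ) (z : ℕ → Cov p) (n : ℕ) (β : Cov p) (x : ℝ) : ℝ :=
  ∑ j ∈ Finset.range n with x ≤ t j, Real.exp (inner ℝ β (z j))

/-- Cox's partial likelihood, the product over the observed events. -/
def partialLikelihood {p : ℕ} (t : ℕ → ℝ) (d : ℕ → Bool) (z : ℕ → Cov p) (n : ℕ)
    (β : Cov p) : ℝ :=
  ∏ i ∈ Finset.range n with d i = true, Real.exp (inner ℝ β (z i)) / riskSum t z n β (t i)

/-- `b` maximizes the partial likelihood over `ℝ^p`. -/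
def IsMaxPartialLikelihood {p : ℕ} (t : ℕ → ℝ) (d : ℕ → Bool) (z : ℕ → Cov p) (n : ℕ)
    (b : Cov p) : Prop :=
  ∀ β, partialLikelihood t d z n β ≤ partialLikelihood t d z n b

/-- The finite set of distinct observed event times. -/
def eventTimes (t : ℕ → ℝ) (d : ℕ → Bool) (n : ℕ) : Finset ℝ :=
  ((Finset.range n).filter (fun i => d i = true)).image t

/-- The number of observed events at time `s`. -/
def numEvents (t : ℕ → ℝ) (d : ℕ → Bool) (n : ℕ) (s : ℝ) : ℕ :=
  ((Finset.range n).filter (fun i => d i = true ∧ t i = s)).card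

/-- The Breslow estimator `Λ_n` with regression coefficients `b` plugged in. -/
def breslow {p : ℕ} (t : ℕ → ℝ) (d : ℕ → Bool) (z : ℕ → Cov p) (n : ℕ) (b : Cov p) (x : ℝ) :
    ℝ :=
  ∑ s ∈ eventTimes t d n with s ≤ x, (numEvents t d n s : ℝ) / riskSum t z n b s

/-- The estimator `F_n = 1 - exp (-Λ_n)` of the baseline distribution function. -/
def baseCDFEst {p : ℕ} (t : ℕ → ℝ) (d : ℕ → Bool) (z : ℕ → Cov p) (n : ℕ) (b : Cov p) (x : ℝ) :
    ℝ :=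
  1 - Real.exp (-breslow t d z n b x)

/-- `betaHat n` is a maximum partial likelihood estimator from the first `n` observations: almost
surely it maximizes the partial likelihood whenever that has a maximizer (for some finite samples
there is none, and then nothing is required). -/
def IsMPLE {p : ℕ} {Ω' : Type*} [MeasurableSpace Ω'] (Q : Measure Ω') (T : ℕ → Ω' → ℝ)
    (Δ : ℕ → Ω' → Bool) (Zs : ℕ → Ω' → Cov p) (betaHat : ℕ → Ω' → Cov p) : Prop :=
  ∀ n, ∀ᵐ ω ∂Q,
    (∃ b, IsMaxPartialLikelihood (fun i => T i ω) (fun i => Δ i ω) (fun i => Zs i ω) n b) →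
      IsMaxPartialLikelihood (fun i => T i ω) (fun i => Δ i ω) (fun i => Zs i ω) n (betaHat n ω)

end

end CoxBreslow

set_option linter.unusedSectionVars false

namespace CoxBreslow

noncomputable section

/-! Write S_β(u) = E[exp(β'Z); T ≥ u] (`riskMean`) and m(du) = λ₀(u) du. The Cox model enters mainly
through one intensity identity, `IsCoxModel.lintegral_event`: E[g(T, Z); Δ = 1] = ∫ E[exp(β₀'Z) g(u,
Z); T ≥ u] m(du). Two choices of g carry the proof. With g = 1{u ≤ x} / S_{β₀}(u) it represents
Λ₀(x) as a mean over observed events (`integral_inv_riskMean`). With g the likelihood ratio exp((β -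
β₀)'z) S_{β₀}(u) / S_β(u), cut off at a time before the end point τ of T, it shows that this ratio
has mean one over events, so by convexity of exp its logarithm has negative mean unless the ratio is
identically one (`exists_integral_logRatio_le`).

If the ratio is identically one, then (β - β₀)'Z is a function of T on the events. Since the risk
sets {T ≥ u} are nested, this function is constant, and identifiability makes the constant zero.
Then β - β₀ is a null direction: it annihilates the covariates of everyone at risk when events can
occur. Such directions change neither the partial likelihood nor the Breslow estimator, so
consistency of the coefficients modulo null directions is enough.

For the sample, fix a realization on which countably many laws of large numbers hold. Risk sums are
monotone in time and Lipschitz in β, with the average of an integrable envelope as constant, so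
Pólya's theorem gives uniform convergence on compact time sets, also along convergent coefficients.
Near τ the limit S_β vanishes and its logarithm is out of control. There only an upper bound for the
log likelihood ratio is needed, and `sum_tail_log_le` supplies one that is small for late
truncation.

Hence near any β close to β₀ and not equivalent to it the likelihood is eventually below its value
at β₀. By compactness this holds on a whole small sphere in the orthogonal complement of the null
directions; by concavity of the log likelihood a maximizer then exists, and every maximizer lies
inside the sphere modulo null directions (`tendsto_normalize`). Finally, on [0, M] the limit S_{β₀}
is bounded away from zero, so the inverse risk sums in the Breslow estimator may be replaced by
their limits, and the law of large numbers with Pólya's theorem gives uniform convergence to Λ₀. -/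

/-- **Pólya's theorem**: antitone functions that converge at all rationals to a continuous
function converge uniformly on compact sets. -/
theorem tendstoUniformlyOn_of_antitone {ι : Type*} {F : Filter ι} {f : ι → ℝ → ℝ} {s : ℝ → ℝ}
    (hf : ∀ i, Antitone (f i)) (hs : Continuous s)
    (h : ∀ q : ℚ, Tendsto (fun i => f i q) F (𝓝 (s q))) {K : Set ℝ} (hK : IsCompact K) :
    TendstoUniformlyOn f s F K := by
  rw [← tendstoLocallyUniformlyOn_iff_tendstoUniformlyOn_of_compact hK,
    Metric.tendstoLocallyUniformlyOn_iff]
  intro ε hε x _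
  obtain ⟨δ, hδ, hδs⟩ := Metric.continuousAt_iff.1 hs.continuousAt (ε / 4) (by positivity)
  obtain ⟨q, hq1, hq2⟩ := exists_rat_btwn (show x - δ < x by linarith)
  obtain ⟨r, hr1, hr2⟩ := exists_rat_btwn (show x < x + δ by linarith)
  have near : ∀ y, x - δ < y → y < x + δ → |s y - s x| < ε / 4 := fun y h1 h2 => by
    have := @hδs y (by rw [Real.dist_eq, abs_lt]; constructor <;> linarith)
    rwa [Real.dist_eq] at this
  refine ⟨Ioo (q : ℝ) r, mem_nhdsWithin_of_mem_nhds (Ioo_mem_nhds hq2 hr1), ?_⟩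
  have h1 := Metric.tendsto_nhds.1 (h q) (ε / 4) (by positivity)
  have h2 := Metric.tendsto_nhds.1 (h r) (ε / 4) (by positivity)
  filter_upwards [h1, h2] with i hi1 hi2 y hy
  rw [Real.dist_eq, abs_lt] at hi1 hi2 ⊢
  have a1 := hf i hy.1.le
  have a2 := hf i hy.2.le
  have b1 := abs_lt.1 (near q hq1 (by linarith))
  have b2 := abs_lt.1 (near r (by linarith) hr2)
  have b3 := abs_lt.1 (near y (by linarith [hy.1]) (by linarith [hy.2]))
  constructor <;> linarith [b1.1, b1.2, b2.1, b2.2, b3.1, b3.2]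

/-! ### Finite sample identities -/

variable {p : ℕ}

theorem riskSum_nonneg (t : ℕ → ℝ) (z : ℕ → Cov p) (n : ℕ) (β : Cov p) (x : ℝ) :
    0 ≤ riskSum t z n β x :=
  Finset.sum_nonneg fun _ _ => (Real.exp_pos _).le

theorem riskSum_antitone (t : ℕ → ℝ) (z : ℕ → Cov p) (n : ℕ) (β : Cov p) :
    Antitone (riskSum t z n β) := by
  intro x y hxy
  refine Finset.sum_le_sum_of_subset_of_nonneg ?_ fun _ _ _ => (Real.exp_pos _).le
  intro j
  simp only [Finset.mem_filter]
  exact fun h => ⟨h.1, hxy.trans h.2⟩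

theorem riskSum_pos (t : ℕ → ℝ) (z : ℕ → Cov p) {n i : ℕ} (hi : i < n) (β : Cov p) :
    0 < riskSum t z n β (t i) :=
  Finset.sum_pos (fun _ _ => Real.exp_pos _)
    ⟨i, Finset.mem_filter.2 ⟨Finset.mem_range.2 hi, le_rfl⟩⟩

theorem partialLikelihood_pos (t : ℕ → ℝ) (d : ℕ → Bool) (z : ℕ → Cov p) (n : ℕ) (β : Cov p) :
    0 < partialLikelihood t d z n β :=
  Finset.prod_pos fun _ hi => div_pos (Real.exp_pos _)
    (riskSum_pos t z (Finset.mem_range.1 (Finset.mem_filter.1 hi).1) β)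

theorem continuous_partialLikelihood (t : ℕ → ℝ) (d : ℕ → Bool) (z : ℕ → Cov p) (n : ℕ) :
    Continuous (partialLikelihood t d z n) := by
  refine continuous_finsetProd _ fun _ hi => Continuous.div (by fun_prop) ?_ fun β =>
    (riskSum_pos t z (Finset.mem_range.1 (Finset.mem_filter.1 hi).1) β).ne'
  exact continuous_finsetSum _ fun j _ => by fun_prop

/-- The log partial likelihood ratio, as a sum over the events. -/
theorem log_partialLikelihood_sub (t : ℕ → ℝ) (d : ℕ → Bool) (z : ℕ → Cov p) (n : ℕ)
    (β β' : Cov p) :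
    Real.log (partialLikelihood t d z n β) - Real.log (partialLikelihood t d z n β') =
      ∑ i ∈ Finset.range n with d i = true, (inner ℝ (β - β') (z i) -
        Real.log (riskSum t z n β (t i) / n) + Real.log (riskSum t z n β' (t i) / n)) := by
  have key : ∀ b, Real.log (partialLikelihood t d z n b) =
      ∑ i ∈ Finset.range n with d i = true,
        (inner ℝ b (z i) - Real.log (riskSum t z n b (t i))) := by
    intro b
    rw [partialLikelihood, Real.log_prod]
    · refine Finset.sum_congr rfl fun i hi => ?_
      rw [Real.log_div (Real.exp_pos _).ne'
        (riskSum_pos t z (Finset.mem_range.1 (Finset.mem_filter.1 hi).1) b).ne', Real.log_exp]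
    · exact fun i hi => (div_pos (Real.exp_pos _)
        (riskSum_pos t z (Finset.mem_range.1 (Finset.mem_filter.1 hi).1) b)).ne'
  rw [key, key, ← Finset.sum_sub_distrib]
  refine Finset.sum_congr rfl fun i hi => ?_
  have hin := Finset.mem_range.1 (Finset.mem_filter.1 hi).1
  have hn : (n : ℝ) ≠ 0 := by
    have : 0 < n := by omega
    positivity
  -- The normalization by n cancels between the two logarithms; it is there because the averages,
  -- not the sums, have limits.
  rw [Real.log_div (riskSum_pos t z hin β).ne' hn, Real.log_div (riskSum_pos t z hin β').ne' hn,
    inner_sub_left]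
  ring

/-- Log-sum-exp is convex. -/
theorem log_sum_exp_convex {ι : Type*} (A : Finset ι) (hA : A.Nonempty) (a b : ι → ℝ) {c : ℝ}
    (hc0 : 0 ≤ c) (hc1 : c ≤ 1) :
    Real.log (∑ j ∈ A, Real.exp ((1 - c) * a j + c * b j)) ≤
      (1 - c) * Real.log (∑ j ∈ A, Real.exp (a j)) + c * Real.log (∑ j ∈ A, Real.exp (b j)) := by
  have pos : ∀ f : ι → ℝ, 0 < ∑ j ∈ A, Real.exp (f j) := fun f =>
    Finset.sum_pos (fun _ _ => Real.exp_pos _) hA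
  set x := Real.log (∑ j ∈ A, Real.exp (a j)) with hx
  set y := Real.log (∑ j ∈ A, Real.exp (b j)) with hy
  -- After subtracting x and y both families of exponentials are probability weights, so convexity
  -- of exp bounds the mixed sum by 1.
  have ex : ∑ j ∈ A, Real.exp (a j - x) = 1 := by
    simp_rw [Real.exp_sub, ← Finset.sum_div, hx, Real.exp_log (pos a)]
    exact div_self (pos a).ne'
  have ey : ∑ j ∈ A, Real.exp (b j - y) = 1 := by
    simp_rw [Real.exp_sub, ← Finset.sum_div, hy, Real.exp_log (pos b)]
    exact div_self (pos b).ne'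
  rw [Real.log_le_iff_le_exp (pos _)]
  have h1 : ∑ j ∈ A, Real.exp ((1 - c) * (a j - x) + c * (b j - y)) ≤ 1 := by
    calc _ ≤ ∑ j ∈ A, ((1 - c) * Real.exp (a j - x) + c * Real.exp (b j - y)) := by
          refine Finset.sum_le_sum fun j _ => ?_
          have := convexOn_exp.2 (mem_univ (a j - x)) (mem_univ (b j - y))
            (sub_nonneg.2 hc1) hc0 (by ring)
          simpa [smul_eq_mul] using this
      _ = 1 := by
          rw [Finset.sum_add_distrib, ← Finset.mul_sum, ← Finset.mul_sum, ex, ey]; ring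
  have h2 : ∑ j ∈ A, Real.exp ((1 - c) * a j + c * b j) =
      Real.exp ((1 - c) * x + c * y) *
        ∑ j ∈ A, Real.exp ((1 - c) * (a j - x) + c * (b j - y)) := by
    rw [Finset.mul_sum]
    refine Finset.sum_congr rfl fun j _ => ?_
    rw [← Real.exp_add]; congr 1; ring
  rw [h2]
  exact mul_le_of_le_one_right (Real.exp_pos _).le h1

/-- The log partial likelihood is concave along segments. -/
theorem log_partialLikelihood_concave (t : ℕ → ℝ) (d : ℕ → Bool) (z : ℕ → Cov p) (n : ℕ)
    (b v : Cov p) {c : ℝ} (hc0 : 0 ≤ c) (hc1 : c ≤ 1) :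
    c * (Real.log (partialLikelihood t d z n (b + v)) - Real.log (partialLikelihood t d z n b)) ≤
      Real.log (partialLikelihood t d z n (b + c • v)) -
        Real.log (partialLikelihood t d z n b) := by
  rw [log_partialLikelihood_sub, log_partialLikelihood_sub, Finset.mul_sum]
  refine Finset.sum_le_sum fun i hi => ?_
  have hin := Finset.mem_range.1 (Finset.mem_filter.1 hi).1
  have hn : (n : ℝ) ≠ 0 := by
    have : 0 < n := by omega
    positivity
  have key := log_sum_exp_convex (Finset.range n |>.filter (t i ≤ t ·))
    ⟨i, Finset.mem_filter.2 ⟨Finset.mem_range.2 hin, le_rfl⟩⟩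
    (fun j => inner ℝ b (z j)) (fun j => inner ℝ (b + v) (z j)) hc0 hc1
  have e : ∀ j, (1 - c) * inner ℝ b (z j) + c * inner ℝ (b + v) (z j) =
      inner ℝ (b + c • v) (z j) := fun j => by
    rw [inner_add_left, inner_add_left, inner_smul_left]
    simp only [RCLike.conj_to_real]; ring
  simp_rw [e] at key
  rw [Real.log_div (riskSum_pos t z hin _).ne' hn, Real.log_div (riskSum_pos t z hin _).ne' hn,
    Real.log_div (riskSum_pos t z hin _).ne' hn, add_sub_cancel_left, add_sub_cancel_left,
    inner_smul_left]
  simp only [riskSum, RCLike.conj_to_real] at key ⊢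
  linarith

/-- If the covariates at risk at the event times lie in `V`, only the `V`-component of the
coefficient vector matters for the risk sums at event times. -/
theorem riskSum_congr_of_inner_eq {t : ℕ → ℝ} {d : ℕ → Bool} {z : ℕ → Cov p} {b b' : Cov p}
    (h : ∀ i j, d i = true → t i ≤ t j → inner ℝ b (z j) = (inner ℝ b' (z j) : ℝ)) (n : ℕ)
    {i : ℕ} (hi : d i = true) : riskSum t z n b (t i) = riskSum t z n b' (t i) :=
  Finset.sum_congr rfl fun j hj => by rw [h i j hi (Finset.mem_filter.1 hj).2]

theorem partialLikelihood_congr_of_inner_eq {t : ℕ → ℝ} {d : ℕ → Bool} {z : ℕ → Cov p}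
    {b b' : Cov p}
    (h : ∀ i j, d i = true → t i ≤ t j → inner ℝ b (z j) = (inner ℝ b' (z j) : ℝ)) (n : ℕ) :
    partialLikelihood t d z n b = partialLikelihood t d z n b' :=
  Finset.prod_congr rfl fun i hi => by
    have hd := (Finset.mem_filter.1 hi).2
    rw [h i i hd le_rfl, riskSum_congr_of_inner_eq h n hd]

/-- The Breslow estimator as a sum over individuals. -/
theorem breslow_eq_sum (t : ℕ → ℝ) (d : ℕ → Bool) (z : ℕ → Cov p) (n : ℕ) (b : Cov p) (x : ℝ) :
    breslow t d z n b x =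
      ∑ i ∈ Finset.range n with d i = true ∧ t i ≤ x, (riskSum t z n b (t i))⁻¹ := by
  classical
  rw [breslow]
  have hmap : ∀ i ∈ (Finset.range n).filter (fun i => d i = true ∧ t i ≤ x),
      t i ∈ (eventTimes t d n).filter (· ≤ x) := by
    intro i hi
    simp only [Finset.mem_filter, eventTimes, Finset.mem_image] at hi ⊢
    exact ⟨⟨i, ⟨hi.1, hi.2.1⟩, rfl⟩, hi.2.2⟩
  rw [← Finset.sum_fiberwise_of_maps_to hmap]
  refine Finset.sum_congr rfl fun s hs => ?_
  have hsx := (Finset.mem_filter.1 hs).2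
  rw [Finset.sum_congr rfl (g := fun _ => (riskSum t z n b s)⁻¹), Finset.sum_const, nsmul_eq_mul,
    div_eq_mul_inv, numEvents, Finset.filter_filter]
  · congr 3
    ext i
    simp only [Finset.mem_filter]
    constructor
    · rintro ⟨h1, h2, rfl⟩; exact ⟨h1, ⟨h2, hsx⟩, rfl⟩
    · rintro ⟨h1, ⟨h2, _⟩, h3⟩; exact ⟨h1, h2, h3⟩
  · intro i hi
    rw [(Finset.mem_filter.1 hi).2]

theorem breslow_congr_of_inner_eq {t : ℕ → ℝ} {d : ℕ → Bool} {z : ℕ → Cov p} {b b' : Cov p}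
    (h : ∀ i j, d i = true → t i ≤ t j → inner ℝ b (z j) = (inner ℝ b' (z j) : ℝ)) (n : ℕ)
    (x : ℝ) : breslow t d z n b x = breslow t d z n b' x := by
  rw [breslow_eq_sum, breslow_eq_sum]
  refine Finset.sum_congr rfl fun i hi => ?_
  rw [riskSum_congr_of_inner_eq h n (Finset.mem_filter.1 hi).2.1]

theorem breslow_nonneg (t : ℕ → ℝ) (d : ℕ → Bool) (z : ℕ → Cov p) (n : ℕ) (b : Cov p) (x : ℝ) :
    0 ≤ breslow t d z n b x := by
  rw [breslow_eq_sum]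
  exact Finset.sum_nonneg fun i _ => inv_nonneg.2 (riskSum_nonneg _ _ _ _ _)

/-! ### The contribution of the last events to the likelihood -/

/-- A discrete version of `∫ dG / √G ≤ 2 √G`. -/
theorem sum_div_sqrt_le {ι : Type*} [DecidableEq ι] (t a : ι → ℝ) (ha : ∀ i, 0 < a i)
    (A : Finset ι) :
    ∑ i ∈ A, a i / √(∑ j ∈ A with t i ≤ t j, a j) ≤ 2 * √(∑ j ∈ A, a j) := by
  -- The earliest index is added last: its risk set is the whole of A, and it can only enlarge the
  -- denominators of the others (it does so at ties).
  induction A using Finset.induction_on_min_value t with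
  | empty => simp
  | insert i s hi hmin ih =>
    have hS : 0 ≤ ∑ j ∈ s, a j := Finset.sum_nonneg fun j _ => (ha j).le
    have htot : ∑ j ∈ insert i s with t i ≤ t j, a j = a i + ∑ j ∈ s, a j := by
      rw [Finset.filter_true_of_mem, Finset.sum_insert hi]
      intro j hj
      rcases Finset.mem_insert.1 hj with rfl | hj
      · exact le_rfl
      · exact hmin j hj
    rw [Finset.sum_insert hi, htot, Finset.sum_insert hi]
    have h1 : ∑ k ∈ s, a k / √(∑ j ∈ insert i s with t k ≤ t j, a j) ≤
        ∑ k ∈ s, a k / √(∑ j ∈ s with t k ≤ t j, a j) := by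
      refine Finset.sum_le_sum fun k hk => ?_
      refine div_le_div_of_nonneg_left (ha k).le (Real.sqrt_pos.2 ?_) (Real.sqrt_le_sqrt ?_)
      · exact Finset.sum_pos (fun j _ => ha j) ⟨k, Finset.mem_filter.2 ⟨hk, le_rfl⟩⟩
      · exact Finset.sum_le_sum_of_subset_of_nonneg
          (Finset.filter_subset_filter _ (Finset.subset_insert _ _)) fun j _ _ => (ha j).le
    set S := ∑ j ∈ s, a j
    have hpos : 0 < a i + S := by linarith [ha i]
    -- The increment of 2√ dominates the new term, so the sum telescopes.
    have hq : a i / √(a i + S) ≤ 2 * √(a i + S) - 2 * √S := by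
      rw [div_le_iff₀ (Real.sqrt_pos.2 hpos)]
      nlinarith [Real.sq_sqrt hpos.le, Real.sq_sqrt hS, sq_nonneg (√(a i + S) - √S)]
    linarith

/-- This bounds the late events from above although the risk sums there may be arbitrarily small.
The logarithmic singularity is traded for 1/√G, where G is the risk sum restricted to A, and this is
summable by `sum_div_sqrt_le`. If A is a small tail, the bound is small. -/
theorem sum_tail_log_le (t : ℕ → ℝ) (z : ℕ → Cov p) (n : ℕ) (β β' : Cov p) (A : Finset ℕ)
    (hA : A ⊆ Finset.range n) {S : ℝ}
    (hS : ∀ i ∈ A, riskSum t z n β' (t i) / n ≤ S) :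
    (∑ i ∈ A, (inner ℝ (β - β') (z i) - Real.log (riskSum t z n β (t i) / n) +
      Real.log (riskSum t z n β' (t i) / n))) / n ≤
      4 * √((∑ i ∈ A, Real.exp (inner ℝ β (z i))) / n) +
        (‖β‖ + ‖β'‖ + S) * ((∑ i ∈ A, (1 + ‖z i‖)) / n) := by
  classical
  rcases Nat.eq_zero_or_pos n with rfl | hn0
  · simp
  have hn : (0 : ℝ) < n := by exact_mod_cast hn0
  set a : ℕ → ℝ := fun i => Real.exp (inner ℝ β (z i)) / n with ha_def
  have ha : ∀ i, 0 < a i := fun i => div_pos (Real.exp_pos _) hn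
  set G : ℕ → ℝ := fun i => ∑ j ∈ A with t i ≤ t j, a j with hG_def
  have hG : ∀ i ∈ A, 0 < G i := fun i hi =>
    Finset.sum_pos (fun j _ => ha j) ⟨i, Finset.mem_filter.2 ⟨hi, le_rfl⟩⟩
  have hGle : ∀ i ∈ A, G i ≤ riskSum t z n β (t i) / n := by
    intro i _
    rw [riskSum, Finset.sum_div]
    exact Finset.sum_le_sum_of_subset_of_nonneg (Finset.filter_subset_filter _ hA)
      fun j _ _ => (ha j).le
  have term : ∀ i ∈ A, (inner ℝ (β - β') (z i) - Real.log (riskSum t z n β (t i) / n) +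
      Real.log (riskSum t z n β' (t i) / n)) / n ≤
      2 * (a i / √(G i)) + (‖β‖ + ‖β'‖ + S) * ((1 + ‖z i‖) / n) := by
    intro i hi
    have hin := Finset.mem_range.1 (hA hi)
    have h1 : Real.log (G i) ≤ Real.log (riskSum t z n β (t i) / n) :=
      Real.log_le_log (hG i hi) (hGle i hi)
    have hpos' : 0 < riskSum t z n β' (t i) / n := div_pos (riskSum_pos t z hin β') hn
    have h2 : Real.log (riskSum t z n β' (t i) / n) ≤ S :=
      (Real.log_le_sub_one_of_pos hpos').trans (by linarith [hS i hi])
    have hsq : 0 < √(G i) := Real.sqrt_pos.2 (hG i hi)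
    -- Applied to exp(β'z)/√G and doubled, this gives 2β'z - log G ≤ 2 exp(β'z)/√G - 2. The surplus
    -- β'z is then absorbed by ‖β‖‖z‖.
    have h3 := Real.log_le_sub_one_of_pos
      (div_pos (Real.exp_pos (inner ℝ β (z i))) hsq)
    rw [Real.log_div (Real.exp_pos _).ne' hsq.ne', Real.log_exp, Real.log_sqrt (hG i hi).le] at h3
    have h4 : -inner ℝ β (z i) ≤ ‖β‖ * ‖z i‖ :=
      (neg_le_abs _).trans (abs_real_inner_le_norm _ _)
    have h5 : -inner ℝ β' (z i) ≤ ‖β'‖ * ‖z i‖ :=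
      (neg_le_abs _).trans (abs_real_inner_le_norm _ _)
    have hS0 : 0 ≤ S := hpos'.le.trans (hS i hi)
    have e1 : 2 * (a i / √(G i)) = 2 * (Real.exp (inner ℝ β (z i)) / √(G i)) / n := by
      rw [ha_def]; field_simp
    rw [e1, mul_div_assoc' (‖β‖ + ‖β'‖ + S), ← add_div]
    refine div_le_div_of_nonneg_right ?_ hn.le
    rw [inner_sub_left]
    nlinarith [norm_nonneg β, norm_nonneg β', norm_nonneg (z i), mul_nonneg hS0 (norm_nonneg (z i))]
  have h1 : ∑ i ∈ A, a i / √(G i) ≤ 2 * √(∑ j ∈ A, a j) := sum_div_sqrt_le t a ha A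
  rw [← Finset.sum_div] at h1
  rw [Finset.sum_div]
  refine (Finset.sum_le_sum term).trans ?_
  rw [Finset.sum_add_distrib, ← Finset.mul_sum, ← Finset.mul_sum, ← Finset.sum_div]
  linarith

end

noncomputable section

variable {p : ℕ} {Ω : Type*} [MeasurableSpace Ω] {P : Measure Ω} [IsProbabilityMeasure P]
  {X C : Ω → ℝ} {Z : Ω → Cov p} {lam0 : ℝ → ℝ} {beta0 : Cov p}

/-! ### The population -/

/-- The measure `λ₀(u) du` on `[0, ∞)`. -/
def hazardMeasure (lam0 : ℝ → ℝ) : Measure ℝ :=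
  (volume.restrict (Ici (0 : ℝ))).withDensity fun u => ENNReal.ofReal (lam0 u)

instance : SFinite (hazardMeasure lam0) := by unfold hazardMeasure; infer_instance

/-- An expectation given the covariates, for an event time with the Cox hazard. -/
theorem lintegral_prod_of_hasHazard {ν ξ : Measure ℝ} [IsProbabilityMeasure ν]
    [IsProbabilityMeasure ξ] (hlam : Measurable lam0) {e : ℝ}
    (hν : HasHazard ν fun x => lam0 x * Real.exp e) {G : ℝ × ℝ → ℝ≥0∞} (hG : Measurable G) :
    ∫⁻ q, G q ∂(ν.prod ξ) = ∫⁻ u, ∫⁻ q, (if u < q.1 then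
      ENNReal.ofReal (Real.exp e) * G (u, q.2) else 0) ∂(ν.prod ξ) ∂(hazardMeasure lam0) := by
  have hsurv : Measurable fun u => ν (Ioi u) :=
    Antitone.measurable fun a b hab => measure_mono (Ioi_subset_Ioi hab)
  have hinner : Measurable fun u => ∫⁻ c, G (u, c) ∂ξ := hG.lintegral_prod_right'
  have e2 : ∀ u, ∫⁻ q, (if u < q.1 then ENNReal.ofReal (Real.exp e) * G (u, q.2) else 0)
      ∂(ν.prod ξ) = ENNReal.ofReal (Real.exp e) * (ν (Ioi u) * ∫⁻ c, G (u, c) ∂ξ) := by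
    intro u
    have hmeas : Measurable fun q : ℝ × ℝ =>
        if u < q.1 then ENNReal.ofReal (Real.exp e) * G (u, q.2) else 0 :=
      Measurable.ite (measurableSet_lt measurable_const measurable_fst) (by fun_prop)
        measurable_const
    rw [lintegral_prod _ hmeas.aemeasurable]
    have : ∀ x, ∫⁻ c, (if u < x then ENNReal.ofReal (Real.exp e) * G (u, c) else 0) ∂ξ =
        (Ioi u).indicator (fun _ => ENNReal.ofReal (Real.exp e) * ∫⁻ c, G (u, c) ∂ξ) x := by
      intro x
      by_cases hx : u < x
      · simp only [hx, if_true, indicator_of_mem (mem_Ioi.2 hx)]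
        rw [lintegral_const_mul _ (by fun_prop)]
      · simp [hx]
    simp_rw [this]
    rw [lintegral_indicator measurableSet_Ioi, lintegral_const, Measure.restrict_apply_univ]
    ring
  simp_rw [e2]
  rw [lintegral_prod _ hG.aemeasurable]
  -- Only the integrating measure is replaced by its density; the ν in the survival factor must
  -- stay. By independence that factor times the integral over ξ is the integral of the product
  -- measure over {u < q.1}.
  nth_rewrite 1 [hν]
  have hd : Measurable fun x => ENNReal.ofReal (lam0 x * Real.exp e) * ν (Ioi x) :=
    (hlam.mul_const _).ennreal_ofReal.mul hsurv
  have hd' : Measurable fun u =>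
      ENNReal.ofReal (Real.exp e) * (ν (Ioi u) * ∫⁻ c, G (u, c) ∂ξ) :=
    (hsurv.mul hinner).const_mul _
  rw [hazardMeasure, lintegral_withDensity_eq_lintegral_mul _ hd hinner,
    lintegral_withDensity_eq_lintegral_mul _ hlam.ennreal_ofReal hd']
  refine lintegral_congr fun u => ?_
  simp only [Pi.mul_apply]
  rw [ENNReal.ofReal_mul' (Real.exp_pos _).le]
  ring

/-- The intensity identity of the Cox model. -/
theorem IsCoxModel.lintegral_eq (h : IsCoxModel P X C Z lam0 beta0) {G : ℝ × ℝ × Cov p → ℝ≥0∞}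
    (hG : Measurable G) :
    ∫⁻ ω, G (X ω, C ω, Z ω) ∂P = ∫⁻ u, ∫⁻ ω, (if u < X ω then
      ENNReal.ofReal (Real.exp (inner ℝ beta0 (Z ω))) * G (u, C ω, Z ω) else 0) ∂P
        ∂(hazardMeasure lam0) := by
  have hX := h.measurable_X
  have hC := h.measurable_C
  have hZ := h.measurable_Z
  have disint : ∀ g : Cov p × (ℝ × ℝ) → ℝ≥0∞, Measurable g →
      ∫⁻ ω, g (Z ω, (X ω, C ω)) ∂P =
        ∫⁻ z, ∫⁻ q, g (z, q) ∂(condDistrib (fun ω => (X ω, C ω)) Z P z) ∂(P.map Z) := by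
    intro g hg
    rw [← Measure.lintegral_compProd hg, compProd_map_condDistrib (by fun_prop),
      lintegral_map hg (by fun_prop)]
  have hset : MeasurableSet {r : ℝ × Cov p × (ℝ × ℝ) | r.1 < r.2.2.1} :=
    measurableSet_lt (by fun_prop) (by fun_prop)
  have hK : Measurable fun r : ℝ × Cov p × (ℝ × ℝ) => if r.1 < r.2.2.1 then
      ENNReal.ofReal (Real.exp (inner ℝ beta0 r.2.1)) * G (r.1, r.2.2.2, r.2.1) else 0 :=
    Measurable.ite hset (by fun_prop) measurable_const
  rw [disint (fun r => G (r.2.1, r.2.2, r.1)) (by fun_prop)]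
  have step : ∀ᵐ z ∂(P.map Z),
      ∫⁻ q, G (q.1, q.2, z) ∂(condDistrib (fun ω => (X ω, C ω)) Z P z) =
        ∫⁻ u, ∫⁻ q, (if u < q.1 then ENNReal.ofReal (Real.exp (inner ℝ beta0 z)) * G (u, q.2, z)
          else 0) ∂(condDistrib (fun ω => (X ω, C ω)) Z P z) ∂(hazardMeasure lam0) := by
    filter_upwards [h.hazard, h.condIndep] with z hz1 hz2
    rw [hz2]
    exact lintegral_prod_of_hasHazard (G := fun q => G (q.1, q.2, z)) h.measurable_lam0 hz1
      (by fun_prop)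
  rw [lintegral_congr_ae step]
  have hswap : Measurable fun r : Cov p × ℝ => ∫⁻ q, (if r.2 < q.1 then
      ENNReal.ofReal (Real.exp (inner ℝ beta0 r.1)) * G (r.2, q.2, r.1) else 0)
        ∂(condDistrib (fun ω => (X ω, C ω)) Z P r.1) := by
    have := Measurable.lintegral_kernel_prod_right
      (κ := (condDistrib (fun ω => (X ω, C ω)) Z P).comap (Prod.fst : Cov p × ℝ → Cov p)
        measurable_fst)
      (f := fun (r : Cov p × ℝ) (q : ℝ × ℝ) => if r.2 < q.1 then
        ENNReal.ofReal (Real.exp (inner ℝ beta0 r.1)) * G (r.2, q.2, r.1) else 0)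
      (hK.comp (f := fun s : (Cov p × ℝ) × (ℝ × ℝ) => (s.1.2, s.1.1, s.2)) (by fun_prop))
    exact this
  rw [lintegral_lintegral_swap hswap.aemeasurable]
  refine lintegral_congr fun u => ?_
  exact (disint (fun r => if u < r.2.1 then
    ENNReal.ofReal (Real.exp (inner ℝ beta0 r.1)) * G (u, r.2.2, r.1) else 0)
    (hK.comp (f := fun s : Cov p × (ℝ × ℝ) => (u, s)) (by fun_prop))).symm

theorem hazardMeasure_singleton (u : ℝ) : hazardMeasure lam0 {u} = 0 :=
  (withDensity_absolutelyContinuous _ _)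
    (Measure.restrict_le_self.absolutelyContinuous (measure_singleton u))

theorem hazardMeasure_Iio : hazardMeasure lam0 (Iio 0) = 0 :=
  (withDensity_absolutelyContinuous _ _) (by
    rw [Measure.restrict_apply measurableSet_Iio, Iio_inter_Ici, Ico_self, measure_empty])

theorem IsCoxModel.measure_X_preimage (h : IsCoxModel P X C Z lam0 beta0) {s : Set ℝ}
    (hs : MeasurableSet s) (h0 : hazardMeasure lam0 s = 0) : P (X ⁻¹' s) = 0 := by
  have : ∫⁻ ω, (X ⁻¹' s).indicator 1 ω ∂P = _ :=
    h.lintegral_eq (G := fun r => s.indicator 1 r.1)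
      ((measurable_one.indicator hs).comp measurable_fst)
  rw [lintegral_indicator_one (h.measurable_X hs)] at this
  rw [this, lintegral_eq_zero_of_ae_eq_zero]
  have hc : ∀ᵐ u ∂(hazardMeasure lam0), u ∉ s := measure_eq_zero_iff_ae_notMem.1 h0
  filter_upwards [hc] with u hu
  simp [indicator_of_notMem hu]

theorem IsCoxModel.measure_C_preimage (h : IsCoxModel P X C Z lam0 beta0) {s : Set ℝ}
    (hs : MeasurableSet s) (h0 : ∀ᵐ z ∂(P.map Z), condDistrib C Z P z s = 0) :
    P (C ⁻¹' s) = 0 := by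
  have e := condDistrib_comp_map (μ := P) (X := Z) (Y := C) h.measurable_Z.aemeasurable
    h.measurable_C.aemeasurable
  rw [← Measure.map_apply h.measurable_C hs, ← e, Measure.bind_apply hs (by fun_prop),
    lintegral_eq_zero_of_ae_eq_zero h0]

theorem IsCoxModel.measure_X_eq (h : IsCoxModel P X C Z lam0 beta0) (u : ℝ) :
    P {ω | X ω = u} = 0 :=
  h.measure_X_preimage (measurableSet_singleton u) (hazardMeasure_singleton u)

theorem IsCoxModel.measure_C_eq (h : IsCoxModel P X C Z lam0 beta0) (u : ℝ) :
    P {ω | C ω = u} = 0 :=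
  h.measure_C_preimage (measurableSet_singleton u) (by
    filter_upwards [h.censoring] with z hz using hz.1 (measure_singleton u))

theorem IsCoxModel.ae_nonneg (h : IsCoxModel P X C Z lam0 beta0) :
    ∀ᵐ ω ∂P, 0 ≤ min (X ω) (C ω) := by
  have h1 : ∀ᵐ ω ∂P, ω ∉ X ⁻¹' Iio 0 := measure_eq_zero_iff_ae_notMem.1
    (h.measure_X_preimage measurableSet_Iio hazardMeasure_Iio)
  have h2 : ∀ᵐ ω ∂P, ω ∉ C ⁻¹' Iio 0 := measure_eq_zero_iff_ae_notMem.1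
    (h.measure_C_preimage measurableSet_Iio (h.censoring.mono fun z hz => hz.2))
  filter_upwards [h1, h2] with ω a b
  simp only [mem_preimage, mem_Iio, not_lt] at a b
  exact le_min a b

/-- The intensity identity for observed events. -/
theorem IsCoxModel.lintegral_event (h : IsCoxModel P X C Z lam0 beta0) {g : ℝ × Cov p → ℝ≥0∞}
    (hg : Measurable g) :
    ∫⁻ ω in {ω | X ω ≤ C ω}, g (min (X ω) (C ω), Z ω) ∂P =
      ∫⁻ u, ∫⁻ ω in {ω | u ≤ min (X ω) (C ω)},
        ENNReal.ofReal (Real.exp (inner ℝ beta0 (Z ω))) * g (u, Z ω) ∂P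
          ∂(hazardMeasure lam0) := by
  have hX := h.measurable_X
  have hC := h.measurable_C
  have hE : MeasurableSet {ω | X ω ≤ C ω} := measurableSet_le hX hC
  have key := h.lintegral_eq (G := fun r => if r.1 ≤ r.2.1 then g (r.1, r.2.2) else 0)
    (Measurable.ite (measurableSet_le (by fun_prop) (by fun_prop)) (by fun_prop)
      measurable_const)
  rw [← lintegral_indicator hE]
  have e1 : ∀ ω, {ω | X ω ≤ C ω}.indicator (fun ω => g (min (X ω) (C ω), Z ω)) ω =
      if X ω ≤ C ω then g (X ω, Z ω) else 0 := by
    intro ω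
    by_cases hω : X ω ≤ C ω
    · simp [hω]
    · simp [hω]
  simp_rw [e1]
  rw [key]
  refine lintegral_congr fun u => ?_
  rw [← lintegral_indicator (measurableSet_le measurable_const (hX.min hC))]
  refine lintegral_congr_ae ?_
  -- X has no atoms, so the strict u < X of the general identity may be replaced by u ≤ X, which
  -- combines with u ≤ C to u ≤ T.
  have hu : ∀ᵐ ω ∂P, ω ∉ {ω | X ω = u} := measure_eq_zero_iff_ae_notMem.1 (h.measure_X_eq u)
  filter_upwards [hu] with ω hω
  replace hω : X ω ≠ u := hω
  by_cases h1 : u < X ω <;> by_cases h2 : u ≤ C ω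
  · simp [h1, h2, h1.le]
  · simp [h1, h2]
  all_goals
    have : ¬ u ≤ X ω := fun hle => h1 (lt_of_le_of_ne hle (Ne.symm hω))
    simp [h1, this]

/-! ### End points of supports -/

theorem supportEnd_lt_imp {ν : Measure ℝ} {u : ℝ} (hu : (u : EReal) < supportEnd ν) :
    0 < ν (Ioi u) := by
  rw [supportEnd, lt_iSup_iff] at hu
  obtain ⟨x, hx⟩ := hu
  rw [lt_iSup_iff] at hx
  obtain ⟨hxs, hx⟩ := hx
  exact Measure.mem_support_iff_forall x |>.1 hxs _ (Ioi_mem_nhds (EReal.coe_lt_coe_iff.1 hx))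

theorem ae_le_supportEnd (ν : Measure ℝ) : ∀ᵐ (x : ℝ) ∂ν, (x : EReal) ≤ supportEnd ν := by
  filter_upwards [Measure.support_mem_ae (μ := ν)] with x hx
  exact le_iSup₂_of_le x hx le_rfl

/-- Under the end point condition the observed times are bounded by some `y` up to which the
baseline hazard is integrable. -/
theorem IsCoxModel.exists_bound (h : IsCoxModel P X C Z lam0 beta0)
    (hA1 : EndPointCondition P X C) :
    ∃ y : ℝ, (∀ᵐ ω ∂P, min (X ω) (C ω) ≤ y) ∧ hazardMeasure lam0 (Iic y) < ⊤ := by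
  -- y is chosen strictly between τ_G and τ_F: then T ≤ C ≤ y almost surely, while X exceeds y with
  -- positive probability.
  obtain ⟨y, hy1, hy2⟩ := EReal.lt_iff_exists_real_btwn.1 hA1.2
  refine ⟨y, ?_, ?_⟩
  · have := ae_of_ae_map h.measurable_C.aemeasurable (ae_le_supportEnd (P.map C))
    filter_upwards [this] with ω hω
    exact (min_le_right _ _).trans (EReal.coe_le_coe_iff.1 (hω.trans hy1.le))
  have hpos : 0 < P {ω | y < X ω} := by
    have := supportEnd_lt_imp hy2
    rwa [Measure.map_apply h.measurable_X measurableSet_Ioi] at this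
  have hmeasE : Measurable fun ω => ENNReal.ofReal (Real.exp (inner ℝ beta0 (Z ω))) := by
    have := h.measurable_Z
    fun_prop
  have hSy : MeasurableSet {ω | y < X ω} := measurableSet_lt measurable_const h.measurable_X
  set c := ∫⁻ ω in {ω | y < X ω}, ENNReal.ofReal (Real.exp (inner ℝ beta0 (Z ω))) ∂P with hc
  have hc0 : c ≠ 0 := by
    intro hcz
    rw [hc, setLIntegral_eq_zero_iff hSy hmeasE] at hcz
    refine hpos.ne' (measure_eq_zero_iff_ae_notMem.2 ?_)
    filter_upwards [hcz] with ω hω hmem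
    have := hω hmem
    rw [ENNReal.ofReal_eq_zero] at this
    exact absurd (Real.exp_pos _) (not_lt.2 this)
  have key := h.lintegral_eq (G := fun r => (Iic y).indicator 1 r.1)
    ((measurable_one.indicator measurableSet_Iic).comp measurable_fst)
  -- P(X ≤ y) is the integral of E[exp(β₀'Z); X > u] over u ≤ y against the hazard measure, and the
  -- integrand is at least c > 0 there.
  have hle : c * hazardMeasure lam0 (Iic y) ≤ 1 := by
    calc c * hazardMeasure lam0 (Iic y) = ∫⁻ u, (Iic y).indicator (fun _ => c) u
          ∂(hazardMeasure lam0) := by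
          rw [lintegral_indicator measurableSet_Iic, lintegral_const, Measure.restrict_apply_univ]
      _ ≤ ∫⁻ u, ∫⁻ ω, (if u < X ω then ENNReal.ofReal (Real.exp (inner ℝ beta0 (Z ω))) *
            (Iic y).indicator 1 u else 0) ∂P ∂(hazardMeasure lam0) := by
          refine lintegral_mono fun u => ?_
          by_cases hu : u ≤ y
          · simp only [indicator_of_mem (mem_Iic.2 hu), hc, Pi.one_apply, mul_one]
            rw [← lintegral_indicator hSy]
            refine lintegral_mono fun ω => ?_
            by_cases hω : y < X ω
            · simp [hω, hu.trans_lt hω]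
            · simp [hω]
          · simp [hu]
      _ = ∫⁻ ω, (Iic y).indicator 1 (X ω) ∂P := key.symm
      _ ≤ ∫⁻ ω, 1 ∂P := lintegral_mono fun ω => indicator_le_self' (by simp) _
      _ = 1 := by simp
  by_contra hcon
  rw [not_lt, top_le_iff] at hcon
  rw [hcon, ENNReal.mul_top hc0] at hle
  exact absurd hle (by simp)

end

/-! ### The moment envelope and the reduced event model -/

noncomputable section

variable {p : ℕ} {Ω : Type*} [MeasurableSpace Ω] {P : Measure Ω} [IsProbabilityMeasure P]
  {X C : Ω → ℝ} {Z : Ω → Cov p} {lam0 : ℝ → ℝ} {beta0 : Cov p}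

/-- An envelope, together with its first moment in `z`, of `exp (β' z)` for `β` in the ball with
center `beta0` and radius `ρ`. -/
def envelope (beta0 : Cov p) (ρ : ℝ) (z : Cov p) : ℝ :=
  (1 + ‖z‖) * Real.exp (inner ℝ beta0 z + ρ * ‖z‖)

theorem envelope_pos (beta0 : Cov p) (ρ : ℝ) (z : Cov p) : 0 < envelope beta0 ρ z :=
  mul_pos (by positivity) (Real.exp_pos _)

theorem measurable_envelope (beta0 : Cov p) (ρ : ℝ) : Measurable (envelope beta0 ρ) := by
  unfold envelope; fun_prop

theorem exp_inner_le_exp {ρ : ℝ} {β : Cov p} (hβ : ‖β - beta0‖ ≤ ρ) (z : Cov p) :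
    Real.exp (inner ℝ β z) ≤ Real.exp (inner ℝ beta0 z + ρ * ‖z‖) := by
  refine Real.exp_le_exp.2 ?_
  have h1 : inner ℝ β z = inner ℝ beta0 z + inner ℝ (β - beta0) z := by
    rw [← inner_add_left]; simp
  have h2 := (real_inner_le_norm (β - beta0) z).trans
    (mul_le_mul_of_nonneg_right hβ (norm_nonneg z))
  linarith

theorem exp_inner_le_envelope {ρ : ℝ} {β : Cov p} (hβ : ‖β - beta0‖ ≤ ρ) (z : Cov p) :
    Real.exp (inner ℝ β z) ≤ envelope beta0 ρ z :=
  (exp_inner_le_exp hβ z).trans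
    (le_mul_of_one_le_left (Real.exp_pos _).le (by linarith [norm_nonneg z]))

theorem abs_exp_sub_exp_le (a b : ℝ) :
    |Real.exp a - Real.exp b| ≤ |a - b| * max (Real.exp a) (Real.exp b) := by
  wlog hab : b ≤ a generalizing a b
  · rw [abs_sub_comm, abs_sub_comm a, max_comm]
    exact this b a (le_of_not_ge hab)
  rw [abs_of_nonneg (sub_nonneg.2 (Real.exp_le_exp.2 hab)), abs_of_nonneg (sub_nonneg.2 hab),
    max_eq_left (Real.exp_le_exp.2 hab)]
  have h1 := Real.add_one_le_exp (b - a)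
  have h2 : Real.exp b = Real.exp a * Real.exp (b - a) := by rw [← Real.exp_add]; congr 1; ring
  nlinarith [Real.exp_pos a]

theorem abs_exp_inner_sub_le {ρ : ℝ} {β β' : Cov p} (hβ : ‖β - beta0‖ ≤ ρ)
    (hβ' : ‖β' - beta0‖ ≤ ρ) (z : Cov p) :
    |Real.exp (inner ℝ β z) - Real.exp (inner ℝ β' z)| ≤ ‖β - β'‖ * envelope beta0 ρ z := by
  refine (abs_exp_sub_exp_le _ _).trans ?_
  rw [← inner_sub_left]
  calc |inner ℝ (β - β') z| * max (Real.exp (inner ℝ β z)) (Real.exp (inner ℝ β' z))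
      ≤ (‖β - β'‖ * ‖z‖) * Real.exp (inner ℝ beta0 z + ρ * ‖z‖) :=
        mul_le_mul (abs_real_inner_le_norm _ _)
          (max_le (exp_inner_le_exp hβ z) (exp_inner_le_exp hβ' z)) (by positivity) (by positivity)
    _ ≤ ‖β - β'‖ * envelope beta0 ρ z := by
        rw [envelope, mul_assoc]
        refine mul_le_mul_of_nonneg_left ?_ (norm_nonneg _)
        exact mul_le_mul_of_nonneg_right (by linarith) (Real.exp_pos _).le

theorem exists_norm_div_le_abs (z : Cov p) (hz : 0 < ‖z‖) : ∃ k, ‖z‖ / (p + 1) ≤ |z k| := by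
  by_contra! hcon
  have h1 : ‖z‖ ^ 2 = ∑ k, |z k| ^ 2 := by
    rw [EuclideanSpace.norm_sq_eq]; rfl
  have h2 : ∑ k, |z k| ^ 2 ≤ ∑ _k : Fin p, (‖z‖ / (p + 1)) ^ 2 :=
    Finset.sum_le_sum fun k _ => pow_le_pow_left₀ (abs_nonneg _) (hcon k).le 2
  rw [Finset.sum_const, Finset.card_univ, Fintype.card_fin, nsmul_eq_mul, ← h1, div_pow,
    mul_div_assoc', le_div_iff₀ (by positivity)] at h2
  have hp : (0 : ℝ) ≤ p := Nat.cast_nonneg p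
  nlinarith [pow_pos hz 2, mul_nonneg hp (pow_pos hz 2).le, mul_nonneg (mul_nonneg hp hp)
    (pow_pos hz 2).le]

/-- The moment condition is needed only at the 2p points β₀ ± ε e_k. Some coordinate of z has size
at least ‖z‖/(p + 1), so moving by ε along it with the right sign gains at least ρ‖z‖ in the
exponent. The inequality 2x ≤ 1 + x² turns the first moment into the assumed second one. -/
theorem MomentCondition.exists_envelope (hZ : Measurable Z) (h : MomentCondition P Z beta0) :
    ∃ ρ : ℝ, 0 < ρ ∧ Integrable (fun ω => envelope beta0 ρ (Z ω)) P := by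
  obtain ⟨ε, hε, hsup⟩ := h
  have hint : ∀ β : Cov p, ‖β - beta0‖ ≤ ε →
      Integrable (fun ω => ‖Z ω‖ ^ 2 * Real.exp (2 * inner ℝ β (Z ω))) P := by
    intro β hβ
    refine ⟨by fun_prop, ?_⟩
    rw [hasFiniteIntegral_iff_ofReal (ae_of_all _ fun ω => by positivity)]
    refine lt_of_le_of_lt ?_ hsup
    exact le_iSup₂ (f := fun (β : Cov p) (_ : β ∈ Metric.closedBall beta0 ε) =>
      ∫⁻ ω, ENNReal.ofReal (‖Z ω‖ ^ 2 * Real.exp (2 * inner ℝ β (Z ω))) ∂P) β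
      (mem_closedBall_iff_norm.2 hβ)
  let b : Bool → Fin p → Cov p := fun s k =>
    beta0 + (if s then ε else -ε) • EuclideanSpace.single k (1 : ℝ)
  have hb : ∀ s k, ‖b s k - beta0‖ ≤ ε := by
    intro s k
    simp only [b, add_sub_cancel_left, norm_smul, PiLp.norm_single, norm_one, mul_one]
    cases s <;> simp [abs_of_pos hε]
  set ρ : ℝ := ε / (p + 1) with hρ
  have hρ0 : 0 < ρ := by positivity
  refine ⟨ρ, hρ0, ?_⟩
  have hdom : Integrable (fun ω => 2 * Real.exp (‖beta0‖ + ρ) + 2 * (1 +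
      ∑ k, ∑ s, ‖Z ω‖ ^ 2 * Real.exp (2 * inner ℝ (b s k) (Z ω)))) P :=
    (integrable_const _).add (((integrable_const _).add (integrable_finsetSum _ fun k _ =>
      integrable_finsetSum _ fun s _ => hint _ (hb s k))).const_mul 2)
  refine hdom.mono' ((measurable_envelope _ _).comp hZ).aestronglyMeasurable
    (ae_of_all _ fun ω => ?_)
  rw [Real.norm_of_nonneg (envelope_pos _ _ _).le]
  set z := Z ω
  have hsum0 : ∀ k s, 0 ≤ ‖z‖ ^ 2 * Real.exp (2 * inner ℝ (b s k) z) := fun k s => by positivity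
  have hS0 : 0 ≤ ∑ k, ∑ s, ‖z‖ ^ 2 * Real.exp (2 * inner ℝ (b s k) z) :=
    Finset.sum_nonneg fun k _ => Finset.sum_nonneg fun s _ => hsum0 k s
  rcases le_or_gt ‖z‖ 1 with h1 | h1
  · have e1 : inner ℝ beta0 z + ρ * ‖z‖ ≤ ‖beta0‖ + ρ := by
      have := real_inner_le_norm beta0 z
      nlinarith [norm_nonneg beta0, norm_nonneg z]
    have : envelope beta0 ρ z ≤ 2 * Real.exp (‖beta0‖ + ρ) :=
      mul_le_mul (by linarith) (Real.exp_le_exp.2 e1) (Real.exp_pos _).le (by norm_num)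
    linarith
  · obtain ⟨k, hk⟩ := exists_norm_div_le_abs z (by linarith)
    have hex : ∃ s, inner ℝ beta0 z + ρ * ‖z‖ ≤ inner ℝ (b s k) z := by
      have e : ρ * ‖z‖ ≤ ε * |z k| := by
        rw [hρ, div_mul_eq_mul_div, ← mul_div_assoc']
        exact mul_le_mul_of_nonneg_left hk hε.le
      have e2 : ∀ s, inner ℝ (b s k) z = inner ℝ beta0 z + (if s then ε else -ε) * z k := by
        intro s
        cases s <;> simp [b, inner_add_left, inner_smul_left,
          EuclideanSpace.inner_single_left]
      rcases abs_cases (z k) with ⟨hz, _⟩ | ⟨hz, _⟩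
      · refine ⟨true, ?_⟩
        rw [e2, if_pos rfl]; rw [hz] at e; linarith
      · refine ⟨false, ?_⟩
        rw [e2, if_neg (by simp)]; rw [hz] at e; linarith
    obtain ⟨s, hs⟩ := hex
    have e3 : ‖z‖ ^ 2 * Real.exp (2 * inner ℝ (b s k) z) ≤
        ∑ k, ∑ s, ‖z‖ ^ 2 * Real.exp (2 * inner ℝ (b s k) z) :=
      (Finset.single_le_sum (fun s _ => hsum0 k s) (Finset.mem_univ s)).trans
        (Finset.single_le_sum (f := fun k => ∑ s, ‖z‖ ^ 2 * Real.exp (2 * inner ℝ (b s k) z))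
          (fun k _ => Finset.sum_nonneg fun s _ => hsum0 k s) (Finset.mem_univ k))
    set w := Real.exp (inner ℝ beta0 z + ρ * ‖z‖) with hw
    have hw0 : 0 < w := Real.exp_pos _
    have e4 : w ^ 2 ≤ Real.exp (2 * inner ℝ (b s k) z) := by
      rw [hw, ← Real.exp_nat_mul]
      refine Real.exp_le_exp.2 ?_
      push_cast
      linarith
    have e5 : envelope beta0 ρ z ≤ 2 * (‖z‖ * w) := by
      rw [envelope, ← hw]; nlinarith
    have e6 : ‖z‖ ^ 2 * w ^ 2 ≤ ‖z‖ ^ 2 * Real.exp (2 * inner ℝ (b s k) z) := by gcongr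
    nlinarith [sq_nonneg (‖z‖ * w - 1), Real.exp_pos (‖beta0‖ + ρ)]

/-- What is used of the joint law of the observed time `T`, of the set `E` on which the event is
observed, and of the covariates: `m` is the measure `λ₀(u) du`, and `τ` is the end point of the
support of `T`. -/
structure EventModel (P : Measure Ω) (T : Ω → ℝ) (E : Set Ω) (Z : Ω → Cov p) (m : Measure ℝ)
    (beta0 : Cov p) (ρ τ : ℝ) : Prop where
  measurable_T : Measurable T
  measurableSet_E : MeasurableSet E
  measurable_Z : Measurable Z
  rho_pos : 0 < ρ
  lintegral_event : ∀ g : ℝ × Cov p → ℝ≥0∞, Measurable g →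
    ∫⁻ ω in E, g (T ω, Z ω) ∂P = ∫⁻ u, ∫⁻ ω in {ω | u ≤ T ω},
      ENNReal.ofReal (Real.exp (inner ℝ beta0 (Z ω))) * g (u, Z ω) ∂P ∂m
  ae_nonneg : ∀ᵐ ω ∂P, 0 ≤ T ω
  ae_ne : ∀ u, ∀ᵐ ω ∂P, T ω ≠ u
  ae_lt : ∀ᵐ ω ∂P, T ω < τ
  measure_ne_zero : ∀ u < τ, P {ω | u ≤ T ω} ≠ 0
  integrable_envelope : Integrable (fun ω => envelope beta0 ρ (Z ω)) P

/-- Restricting the hazard measure to `Iic y` makes it finite and loses nothing, since the risk sets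
at times after y are null. The end point is a real number, and T stays strictly below it because T
has no atoms. -/
theorem IsCoxModel.exists_eventModel (h : IsCoxModel P X C Z lam0 beta0)
    (hA1 : EndPointCondition P X C) (hA2 : MomentCondition P Z beta0) {M : ℝ}
    (hM : (M : EReal) < supportEnd (P.map fun ω => min (X ω) (C ω))) :
    ∃ y ρ τ : ℝ, M < τ ∧ τ ≤ y ∧ hazardMeasure lam0 (Iic y) < ⊤ ∧
      EventModel P (fun ω => min (X ω) (C ω)) {ω | X ω ≤ C ω} Z
        ((hazardMeasure lam0).restrict (Iic y)) beta0 ρ τ := by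
  obtain ⟨y, hy, hfin⟩ := h.exists_bound hA1
  obtain ⟨ρ, hρ, henv⟩ := hA2.exists_envelope h.measurable_Z
  have hT : Measurable fun ω => min (X ω) (C ω) := h.measurable_X.min h.measurable_C
  set ν := P.map fun ω => min (X ω) (C ω) with hν
  have hpos : ∀ u : ℝ, (u : EReal) < supportEnd ν → P {ω | u ≤ min (X ω) (C ω)} ≠ 0 := by
    intro u hu
    have h1 := supportEnd_lt_imp hu
    rw [hν, Measure.map_apply hT measurableSet_Ioi] at h1
    exact (h1.trans_le (measure_mono fun ω (hω : u < min (X ω) (C ω)) => hω.le)).ne'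
  have hle : ∀ u : ℝ, (u : EReal) < supportEnd ν → u ≤ y := by
    intro u hu
    by_contra! hcon
    refine hpos u hu (measure_eq_zero_iff_ae_notMem.2 ?_)
    filter_upwards [hy] with ω hω hmem
    exact absurd (lt_of_le_of_lt hω hcon) (not_lt.2 hmem)
  have hley : supportEnd ν ≤ y := by
    by_contra! hcon
    obtain ⟨v, hv1, hv2⟩ := EReal.lt_iff_exists_real_btwn.1 hcon
    exact absurd (hle v hv2) (not_le.2 (EReal.coe_lt_coe_iff.1 hv1))
  obtain ⟨τ, hτ⟩ : ∃ τ : ℝ, supportEnd ν = τ := by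
    lift supportEnd ν to ℝ using ⟨(hley.trans_lt (EReal.coe_lt_top y)).ne,
      (bot_le.trans_lt hM).ne'⟩ with τ
    exact ⟨τ, rfl⟩
  rw [hτ] at hM hley hpos
  have hne : ∀ u, ∀ᵐ ω ∂P, min (X ω) (C ω) ≠ u := by
    intro u
    have h1 : ∀ᵐ ω ∂P, ω ∉ {ω | X ω = u} := measure_eq_zero_iff_ae_notMem.1 (h.measure_X_eq u)
    have h2 : ∀ᵐ ω ∂P, ω ∉ {ω | C ω = u} := measure_eq_zero_iff_ae_notMem.1 (h.measure_C_eq u)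
    filter_upwards [h1, h2] with ω a b hmin
    rcases min_choice (X ω) (C ω) with e | e
    · exact a (e.symm.trans hmin)
    · exact b (e.symm.trans hmin)
  refine ⟨y, ρ, τ, EReal.coe_lt_coe_iff.1 hM, EReal.coe_le_coe_iff.1 hley, hfin, hT,
    measurableSet_le h.measurable_X h.measurable_C, h.measurable_Z, hρ, ?_, h.ae_nonneg, hne, ?_,
    fun u hu => hpos u (EReal.coe_lt_coe_iff.2 hu), henv⟩
  · intro g hg
    rw [h.lintegral_event hg, ← lintegral_indicator measurableSet_Iic]
    refine lintegral_congr fun u => ?_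
    by_cases hu : u ≤ y
    · rw [indicator_of_mem (mem_Iic.2 hu)]
    · rw [indicator_of_notMem (by simpa using hu)]
      have : P {ω | u ≤ min (X ω) (C ω)} = 0 := by
        refine measure_eq_zero_iff_ae_notMem.2 ?_
        filter_upwards [hy] with ω hω hmem
        exact hu (le_trans hmem hω)
      rw [Measure.restrict_eq_zero.2 this, lintegral_zero_measure]
  · have h1 := ae_of_ae_map hT.aemeasurable (ae_le_supportEnd ν)
    filter_upwards [h1, hne τ] with ω a b
    rw [hτ] at a
    exact lt_of_le_of_ne (EReal.coe_le_coe_iff.1 a) b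

end

noncomputable section

variable {p : ℕ} {Ω : Type*} [MeasurableSpace Ω] {P : Measure Ω} [IsProbabilityMeasure P]
  {T : Ω → ℝ} {E : Set Ω} {Z : Ω → Cov p} {m : Measure ℝ} {beta0 : Cov p} {ρ τ : ℝ}

/-! ### Consequences for the population -/

theorem continuous_setIntegral_le {φ : Ω → ℝ} (hT : Measurable T) (hne : ∀ u, ∀ᵐ ω ∂P, T ω ≠ u)
    (hφ : Integrable φ P) : Continuous fun u => ∫ ω in {ω | u ≤ T ω}, φ ω ∂P := by
  have e : ∀ u, ∫ ω in {ω | u ≤ T ω}, φ ω ∂P = ∫ ω, {ω | u ≤ T ω}.indicator φ ω ∂P := fun u =>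
    (integral_indicator (measurableSet_le measurable_const hT)).symm
  simp_rw [e]
  rw [continuous_iff_continuousAt]
  intro u
  refine continuousAt_of_dominated (bound := fun ω => ‖φ ω‖) (Eventually.of_forall fun v =>
    hφ.aestronglyMeasurable.indicator (measurableSet_le measurable_const hT))
    (Eventually.of_forall fun v => ae_of_all _ fun ω => norm_indicator_le_norm_self _ _)
    hφ.norm ?_
  filter_upwards [hne u] with ω hω
  refine ContinuousAt.congr (f := fun _ => {ω | u ≤ T ω}.indicator φ ω) continuousAt_const ?_
  rcases lt_or_gt_of_ne hω with h | h
  · filter_upwards [lt_mem_nhds h] with v hv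
    simp [indicator, not_le.2 h, not_le.2 hv]
  · filter_upwards [gt_mem_nhds h] with v hv
    simp [indicator, h.le, hv.le]

theorem continuous_setIntegral_ge {φ : Ω → ℝ} (hT : Measurable T) (hne : ∀ u, ∀ᵐ ω ∂P, T ω ≠ u)
    (hφ : Integrable φ P) : Continuous fun u => ∫ ω in {ω | T ω ≤ u}, φ ω ∂P := by
  have h := (continuous_setIntegral_le (T := fun ω => -T ω) hT.neg
    (fun u => (hne (-u)).mono fun ω hω e => hω (by rw [← e, neg_neg])) hφ).comp continuous_neg
  simpa [Function.comp_def] using h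

/-- If `exp r` has mean one on `S`, then `r` has the negative mean `-E (exp r - 1 - r)`. -/
theorem setIntegral_eq_neg_of_lintegral_exp {r : Ω → ℝ} (hrm : Measurable r) {S : Set Ω}
    (hr : IntegrableOn r S P) (h1 : ∫⁻ ω in S, ENNReal.ofReal (Real.exp (r ω)) ∂P = P S) :
    IntegrableOn (fun ω => Real.exp (r ω) - 1 - r ω) S P ∧
      ∫ ω in S, r ω ∂P = -∫ ω in S, (Real.exp (r ω) - 1 - r ω) ∂P := by
  have hexp : IntegrableOn (fun ω => Real.exp (r ω)) S P := by
    refine ⟨by fun_prop, ?_⟩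
    rw [hasFiniteIntegral_iff_ofReal (ae_of_all _ fun ω => (Real.exp_pos _).le), h1]
    exact measure_lt_top _ _
  have hexp1 : Integrable (fun ω => Real.exp (r ω) - 1) (P.restrict S) :=
    hexp.sub (integrable_const _)
  refine ⟨hexp1.sub hr, ?_⟩
  have e1 : ∫ ω in S, Real.exp (r ω) ∂P = P.real S := by
    rw [integral_eq_lintegral_of_nonneg_ae (ae_of_all _ fun ω => (Real.exp_pos _).le)
      (by fun_prop), h1]
    rfl
  rw [integral_sub hexp1 hr, integral_sub hexp (integrable_const _), e1]
  simp

/-- The population version of the risk sums. -/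
def riskMean (P : Measure Ω) (T : Ω → ℝ) (Z : Ω → Cov p) (β : Cov p) (u : ℝ) : ℝ :=
  ∫ ω in {ω | u ≤ T ω}, Real.exp (inner ℝ β (Z ω)) ∂P

namespace EventModel

theorem integrable_exp (h : EventModel P T E Z m beta0 ρ τ) {β : Cov p}
    (hβ : ‖β - beta0‖ ≤ ρ) : Integrable (fun ω => Real.exp (inner ℝ β (Z ω))) P := by
  have hZ := h.measurable_Z
  refine h.integrable_envelope.mono' (by fun_prop) (ae_of_all _ fun ω => ?_)
  rw [Real.norm_of_nonneg (Real.exp_pos _).le]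
  exact exp_inner_le_envelope hβ _

theorem continuous_riskMean (h : EventModel P T E Z m beta0 ρ τ) {β : Cov p}
    (hβ : ‖β - beta0‖ ≤ ρ) : Continuous (riskMean P T Z β) :=
  continuous_setIntegral_le h.measurable_T h.ae_ne (h.integrable_exp hβ)

theorem measurableSet_risk (h : EventModel P T E Z m beta0 ρ τ) (u : ℝ) :
    MeasurableSet {ω | u ≤ T ω} :=
  measurableSet_le measurable_const h.measurable_T

theorem measurableSet_le (h : EventModel P T E Z m beta0 ρ τ) (u : ℝ) :
    MeasurableSet {ω | T ω ≤ u} :=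
  _root_.measurableSet_le h.measurable_T measurable_const

theorem riskMean_antitone (h : EventModel P T E Z m beta0 ρ τ) {β : Cov p}
    (hβ : ‖β - beta0‖ ≤ ρ) : Antitone (riskMean P T Z β) := fun _ _ huv =>
  setIntegral_mono_set (h.integrable_exp hβ).integrableOn
    (ae_of_all _ fun _ => (Real.exp_pos _).le)
    (Eventually.of_forall fun ω (hω : _ ≤ T ω) => huv.trans hω)

/-- The integrand exp(β₀'z - ρ‖z‖) lies below every exp(β'z) with β in the ball, and {T ≥ M} is
contained in every earlier risk set; so one positive integral bounds all of them. -/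
theorem exists_riskMean_lower (h : EventModel P T E Z m beta0 ρ τ) {M : ℝ} (hM : M < τ) :
    ∃ κ : ℝ, 0 < κ ∧ ∀ β, ‖β - beta0‖ ≤ ρ → ∀ u ≤ M, κ ≤ riskMean P T Z β u := by
  have hZ := h.measurable_Z
  have hle : ∀ β : Cov p, ‖β - beta0‖ ≤ ρ → ∀ ω,
      Real.exp (inner ℝ beta0 (Z ω) - ρ * ‖Z ω‖) ≤ Real.exp (inner ℝ β (Z ω)) := by
    intro β hβ ω
    refine Real.exp_le_exp.2 ?_
    have h1 : inner ℝ beta0 (Z ω) = inner ℝ β (Z ω) + inner ℝ (beta0 - β) (Z ω) := by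
      rw [← inner_add_left]; simp
    have h2 := (real_inner_le_norm (beta0 - β) (Z ω)).trans
      (mul_le_mul_of_nonneg_right (by rwa [norm_sub_rev] : ‖beta0 - β‖ ≤ ρ) (norm_nonneg (Z ω)))
    linarith
  have h0 : ‖beta0 - beta0‖ ≤ ρ := by simpa using h.rho_pos.le
  have hint : Integrable (fun ω => Real.exp (inner ℝ beta0 (Z ω) - ρ * ‖Z ω‖)) P := by
    refine (h.integrable_exp h0).mono' (by fun_prop) (ae_of_all _ fun ω => ?_)
    rw [Real.norm_of_nonneg (Real.exp_pos _).le]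
    exact hle beta0 h0 ω
  refine ⟨∫ ω in {ω | M ≤ T ω}, Real.exp (inner ℝ beta0 (Z ω) - ρ * ‖Z ω‖) ∂P, ?_, ?_⟩
  · rw [setIntegral_pos_iff_support_of_nonneg_ae (ae_of_all _ fun _ => (Real.exp_pos _).le)
      hint.integrableOn]
    have : Function.support (fun ω => Real.exp (inner ℝ beta0 (Z ω) - ρ * ‖Z ω‖)) = univ :=
      eq_univ_of_forall fun ω => (Real.exp_pos _).ne'
    rw [this, univ_inter]
    exact pos_iff_ne_zero.2 (h.measure_ne_zero M hM)
  · intro β hβ u hu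
    refine le_trans ?_ (h.riskMean_antitone hβ hu)
    exact setIntegral_mono hint.integrableOn (h.integrable_exp hβ).integrableOn (hle β hβ)

theorem riskMean_pos (h : EventModel P T E Z m beta0 ρ τ) {β : Cov p} (hβ : ‖β - beta0‖ ≤ ρ)
    {u : ℝ} (hu : u < τ) : 0 < riskMean P T Z β u := by
  obtain ⟨κ, hκ, hle⟩ := h.exists_riskMean_lower hu
  exact hκ.trans_le (hle β hβ u le_rfl)

theorem abs_riskMean_sub_le (h : EventModel P T E Z m beta0 ρ τ) {β β' : Cov p}
    (hβ : ‖β - beta0‖ ≤ ρ) (hβ' : ‖β' - beta0‖ ≤ ρ) (u : ℝ) :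
    |riskMean P T Z β u - riskMean P T Z β' u| ≤
      ‖β - β'‖ * ∫ ω, envelope beta0 ρ (Z ω) ∂P := by
  rw [riskMean, riskMean, ← integral_sub (h.integrable_exp hβ).integrableOn
    (h.integrable_exp hβ').integrableOn, ← integral_const_mul, ← Real.norm_eq_abs]
  refine (norm_integral_le_of_norm_le (h.integrable_envelope.const_mul _).integrableOn
    (ae_of_all _ fun ω => abs_exp_inner_sub_le hβ hβ' (Z ω))).trans ?_
  exact setIntegral_le_integral (h.integrable_envelope.const_mul _)
    (ae_of_all _ fun ω => mul_nonneg (norm_nonneg _) (envelope_pos _ _ _).le)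

/-- Exponential tilting: the factor exp((β - β₀)'Z) turns the true intensity weight exp(β₀'Z) into
exp(β'Z), so the inner integral becomes S_β(u). -/
theorem lintegral_event_exp (h : EventModel P T E Z m beta0 ρ τ) {β : Cov p}
    (hβ : ‖β - beta0‖ ≤ ρ) {w : ℝ → ℝ≥0∞} (hw : Measurable w) :
    ∫⁻ ω in E, ENNReal.ofReal (Real.exp (inner ℝ (β - beta0) (Z ω))) * w (T ω) ∂P =
      ∫⁻ u, ENNReal.ofReal (riskMean P T Z β u) * w u ∂m := by
  have hZ := h.measurable_Z
  refine (h.lintegral_event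
    (fun r => ENNReal.ofReal (Real.exp (inner ℝ (β - beta0) r.2)) * w r.1) (by fun_prop)).trans ?_
  refine lintegral_congr fun u => ?_
  rw [riskMean, ofReal_integral_eq_lintegral_ofReal (h.integrable_exp hβ).integrableOn
    (ae_of_all _ fun ω => (Real.exp_pos _).le), ← lintegral_mul_const _ (by fun_prop)]
  refine lintegral_congr fun ω => ?_
  rw [← mul_assoc, ← ENNReal.ofReal_mul (Real.exp_pos _).le, ← Real.exp_add, ← inner_add_left,
    add_sub_cancel]

/-- The envelope need not dominate 1 + ‖Z‖ itself, but on events the intensity identity supplies the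
missing factor exp(β₀'Z), at the cost of the finite total mass of m. -/
theorem integrableOn_norm [IsFiniteMeasure m] (h : EventModel P T E Z m beta0 ρ τ) :
    IntegrableOn (fun ω => 1 + ‖Z ω‖) E P := by
  have hZ := h.measurable_Z
  refine ⟨by fun_prop, ?_⟩
  rw [hasFiniteIntegral_iff_ofReal (ae_of_all _ fun ω => by positivity)]
  refine (h.lintegral_event (fun r => ENNReal.ofReal (1 + ‖r.2‖)) (by fun_prop)).trans_lt ?_
  calc ∫⁻ u, ∫⁻ ω in {ω | u ≤ T ω}, ENNReal.ofReal (Real.exp (inner ℝ beta0 (Z ω))) *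
        ENNReal.ofReal (1 + ‖Z ω‖) ∂P ∂m
      ≤ ∫⁻ _u, ∫⁻ ω, ENNReal.ofReal (envelope beta0 ρ (Z ω)) ∂P ∂m := by
        refine lintegral_mono fun u => (setLIntegral_le_lintegral _ _).trans
          (lintegral_mono fun ω => ?_)
        rw [← ENNReal.ofReal_mul (Real.exp_pos _).le, envelope, mul_comm (Real.exp _)]
        refine ENNReal.ofReal_le_ofReal (mul_le_mul_of_nonneg_left (Real.exp_le_exp.2 ?_)
          (by positivity))
        linarith [mul_nonneg h.rho_pos.le (norm_nonneg (Z ω))]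
    _ < ⊤ := by
        rw [lintegral_const]
        refine ENNReal.mul_lt_top ?_ (measure_lt_top _ _)
        have := h.integrable_envelope.hasFiniteIntegral
        rwa [hasFiniteIntegral_iff_ofReal (ae_of_all _ fun ω => (envelope_pos _ _ _).le)] at this

/-! ### Linear relations on events and on risk sets -/

theorem ae_event_iff [SFinite m] (h : EventModel P T E Z m beta0 ρ τ) {B : Set (ℝ × Cov p)}
    (hB : MeasurableSet B) :
    (∀ᵐ ω ∂P, ω ∈ E → (T ω, Z ω) ∈ B) ↔ ∀ᵐ u ∂m, ∀ᵐ ω ∂P, u ≤ T ω → (u, Z ω) ∈ B := by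
  have hZ := h.measurable_Z
  have hT := h.measurable_T
  have hg : Measurable (Bᶜ.indicator (1 : ℝ × Cov p → ℝ≥0∞)) := measurable_one.indicator hB.compl
  have hk : Measurable fun r : ℝ × Ω => {r : ℝ × Ω | r.1 ≤ T r.2}.indicator (fun r =>
      ENNReal.ofReal (Real.exp (inner ℝ beta0 (Z r.2))) *
        Bᶜ.indicator (1 : ℝ × Cov p → ℝ≥0∞) (r.1, Z r.2)) r :=
    Measurable.indicator (by fun_prop) (_root_.measurableSet_le (by fun_prop) (by fun_prop))
  -- Both statements say that one side of the intensity identity vanishes for the indicator of the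
  -- complement of B; the weight exp(β₀'Z) is positive and does not matter.
  have key := h.lintegral_event _ hg
  have e1 : (∀ᵐ ω ∂P, ω ∈ E → (T ω, Z ω) ∈ B) ↔
      ∫⁻ ω in E, Bᶜ.indicator (1 : ℝ × Cov p → ℝ≥0∞) (T ω, Z ω) ∂P = 0 := by
    rw [setLIntegral_eq_zero_iff h.measurableSet_E (by fun_prop)]
    refine eventually_congr (ae_of_all _ fun ω => ?_)
    simp
  have e2 : ∀ u, ∫⁻ ω in {ω | u ≤ T ω}, ENNReal.ofReal (Real.exp (inner ℝ beta0 (Z ω))) *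
      Bᶜ.indicator 1 (u, Z ω) ∂P = ∫⁻ ω, {r : ℝ × Ω | r.1 ≤ T r.2}.indicator (fun r =>
      ENNReal.ofReal (Real.exp (inner ℝ beta0 (Z r.2))) *
        Bᶜ.indicator (1 : ℝ × Cov p → ℝ≥0∞) (r.1, Z r.2)) (u, ω) ∂P := by
    intro u
    rw [← lintegral_indicator (h.measurableSet_risk u)]
    rfl
  simp_rw [e2] at key
  rw [e1, key, lintegral_eq_zero_iff hk.lintegral_prod_right']
  refine eventually_congr (ae_of_all _ fun u => ?_)
  refine (lintegral_eq_zero_iff (hk.comp (measurable_prodMk_left (x := u)))).trans ?_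
  refine eventually_congr (ae_of_all _ fun ω => ?_)
  by_cases hu : u ≤ T ω
  · simp [hu, indicator_apply, Real.exp_pos]
  · simp [hu]

/-- A covariate restriction seen on events holds on the risk set at m-almost every time. Exchanging
the order of the null sets, it holds for every subject under observation during a time set of
positive hazard mass, censored or not. -/
theorem ae_of_event [SFinite m] (h : EventModel P T E Z m beta0 ρ τ) {B : Set (Cov p)}
    (hB : MeasurableSet B) (hEB : ∀ᵐ ω ∂P, ω ∈ E → Z ω ∈ B) :
    ∀ᵐ ω ∂P, m (Iic (T ω)) ≠ 0 → Z ω ∈ B := by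
  have h1 := (h.ae_event_iff (B := Prod.snd ⁻¹' B) (measurable_snd hB)).1 hEB
  have hset : MeasurableSet {r : ℝ × Ω | r.1 ≤ T r.2 → Z r.2 ∈ B} := by
    have := h.measurable_T
    have := h.measurable_Z
    exact MeasurableSet.imp (_root_.measurableSet_le (by fun_prop) (by fun_prop))
      ((h.measurable_Z.comp measurable_snd) hB)
  have h2 : ∀ᵐ ω ∂P, ∀ᵐ u ∂m, u ≤ T ω → Z ω ∈ B := (Measure.ae_ae_comm hset).1 h1
  filter_upwards [h2] with ω hω hpos
  by_contra hZB
  refine hpos (measure_eq_zero_iff_ae_notMem.2 ?_)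
  filter_upwards [hω] with u hu hmem
  exact hZB (hu hmem)

end EventModel

/-- The times with no hazard mass up to them form a lower set: either it has a greatest element, or
it is covered by countably many null rays with rational end points. -/
theorem ae_measure_Iic_ne_zero (m : Measure ℝ) : ∀ᵐ u ∂m, m (Iic u) ≠ 0 := by
  set I : Set ℝ := {u | m (Iic u) = 0} with hI
  suffices m I = 0 from measure_eq_zero_iff_ae_notMem.1 this
  by_cases hmax : ∃ a ∈ I, ∀ u ∈ I, u ≤ a
  · obtain ⟨a, ha, hle⟩ := hmax
    exact measure_mono_null (fun u hu => hle u hu) (ha : m (Iic a) = 0)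
  push Not at hmax
  have hsub : I ⊆ ⋃ q ∈ {q : ℚ | (q : ℝ) ∈ I}, Iic (q : ℝ) := by
    intro u hu
    obtain ⟨v, hv, huv⟩ := hmax u hu
    obtain ⟨q, hq1, hq2⟩ := exists_rat_btwn huv
    have hqI : (q : ℝ) ∈ I := measure_mono_null (Iic_subset_Iic.2 hq2.le) (hv : m (Iic v) = 0)
    exact mem_biUnion hqI hq1.le
  refine measure_mono_null hsub ((measure_biUnion_null_iff (to_countable _)).2 fun q hq => hq)

namespace EventModel

theorem ae_event_measure_ne_zero [SFinite m] (h : EventModel P T E Z m beta0 ρ τ) :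
    ∀ᵐ ω ∂P, ω ∈ E → m (Iic (T ω)) ≠ 0 := by
  have hm : Measurable fun u => m (Iic u) :=
    Monotone.measurable fun a b hab => measure_mono (Iic_subset_Iic.2 hab)
  refine (h.ae_event_iff (B := {r | m (Iic r.1) ≠ 0})
    ((hm.comp measurable_fst) (measurableSet_singleton 0).compl)).2 ?_
  filter_upwards [ae_measure_Iic_ne_zero m] with u hu
  exact ae_of_all _ fun _ _ => hu

/-- If on the observed events a linear combination of the covariates is a function of the time,
then it is constant there. -/
theorem exists_const_of_event [SFinite m] (h : EventModel P T E Z m beta0 ρ τ) {c : Cov p}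
    {a : ℝ → ℝ} (ha : Measurable a) (hc : ∀ᵐ ω ∂P, ω ∈ E → inner ℝ c (Z ω) = a (T ω)) :
    ∃ k : ℝ, ∀ᵐ ω ∂P, ω ∈ E → inner ℝ c (Z ω) = k := by
  have hset : MeasurableSet {r : ℝ × Cov p | inner ℝ c r.2 = a r.1} :=
    measurableSet_eq_fun (by fun_prop) (by fun_prop)
  have hset' : ∀ k : ℝ, MeasurableSet {r : ℝ × Cov p | inner ℝ c r.2 = k} := fun k =>
    measurableSet_eq_fun (by fun_prop) measurable_const
  have h1 := (h.ae_event_iff hset).1 hc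
  -- Any such u supplies the constant a(u): for another good time v the later of the two risk sets
  -- lies in both, so if it is not null, a(u) = a(v) can be read off from one of its points. If no
  -- such u exists, the risk sets at m-almost all times are null, and any constant will do.
  by_cases hex : ∃ u, P {ω | u ≤ T ω} ≠ 0 ∧ ∀ᵐ ω ∂P, u ≤ T ω → inner ℝ c (Z ω) = a u
  · obtain ⟨u, hu0, hu⟩ := hex
    refine ⟨a u, (h.ae_event_iff (hset' (a u))).2 ?_⟩
    filter_upwards [h1] with v hv
    by_cases hv0 : P {ω | max u v ≤ T ω} = 0
    · rcases le_total u v with huv | huv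
      · rw [max_eq_right huv] at hv0
        filter_upwards [measure_eq_zero_iff_ae_notMem.1 hv0] with ω hω hvω
        exact absurd hvω hω
      · rw [max_eq_left huv] at hv0
        exact absurd hv0 hu0
    · have hfreq : ∃ᵐ ω ∂P, max u v ≤ T ω := frequently_ae_iff.2 hv0
      obtain ⟨ω, hω, e1, e2⟩ := (hfreq.and_eventually (hu.and hv)).exists
      have e : a v = a u :=
        (e2 ((le_max_right _ _).trans hω)).symm.trans (e1 ((le_max_left _ _).trans hω))
      filter_upwards [hv] with ω hω hvω
      exact (hω hvω).trans e
  · refine ⟨0, (h.ae_event_iff (hset' 0)).2 ?_⟩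
    filter_upwards [h1] with v hv
    by_cases hv0 : P {ω | v ≤ T ω} = 0
    · filter_upwards [measure_eq_zero_iff_ae_notMem.1 hv0] with ω hω hvω
      exact absurd hvω hω
    · exact absurd ⟨v, hv0, hv⟩ hex

/-- This is where identifiability acts: a nonzero constant k could be rescaled to 1 by k⁻¹ • c,
which would exclude events altogether. Zero then spreads from events to everyone at risk. -/
theorem inner_eq_zero_of_event [SFinite m] (h : EventModel P T E Z m beta0 ρ τ)
    (hId : ∀ c : Cov p, (∀ᵐ ω ∂P, ω ∈ E → inner ℝ c (Z ω) = 1) → ∀ᵐ ω ∂P, ω ∉ E) {c : Cov p}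
    {a : ℝ → ℝ} (ha : Measurable a) (hc : ∀ᵐ ω ∂P, ω ∈ E → inner ℝ c (Z ω) = a (T ω)) :
    ∀ᵐ ω ∂P, m (Iic (T ω)) ≠ 0 → inner ℝ c (Z ω) = 0 := by
  have hset : MeasurableSet {z : Cov p | inner ℝ c z = 0} :=
    measurableSet_eq_fun (by fun_prop) measurable_const
  refine h.ae_of_event hset ?_
  obtain ⟨k, hk⟩ := h.exists_const_of_event ha hc
  rcases eq_or_ne k 0 with rfl | hk0
  · exact hk
  · have := hId (k⁻¹ • c) (by
      filter_upwards [hk] with ω hω hE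
      rw [inner_smul_left, hω hE]
      simp [hk0])
    filter_upwards [this] with ω hω hE
    exact absurd hE hω

/-! ### The population likelihood ratio -/

/-- The logarithm of the limit of the likelihood ratio of an event. -/
def logRatio (P : Measure Ω) (T : Ω → ℝ) (Z : Ω → Cov p) (beta0 β : Cov p) (u : ℝ) (z : Cov p) :
    ℝ :=
  inner ℝ (β - beta0) z - Real.log (riskMean P T Z β u) + Real.log (riskMean P T Z beta0 u)

theorem measurable_logRatio (h : EventModel P T E Z m beta0 ρ τ) {β : Cov p}
    (hβ : ‖β - beta0‖ ≤ ρ) :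
    Measurable fun ω => logRatio P T Z beta0 β (T ω) (Z ω) := by
  have h1 := (h.continuous_riskMean hβ).measurable
  have h2 := (h.continuous_riskMean (β := beta0) (by simpa using h.rho_pos.le)).measurable
  have hT := h.measurable_T
  have hZ := h.measurable_Z
  unfold logRatio
  fun_prop

theorem exists_abs_log_riskMean_le (h : EventModel P T E Z m beta0 ρ τ) {M : ℝ} (hM : M < τ) :
    ∃ K : ℝ, ∀ β, ‖β - beta0‖ ≤ ρ → ∀ u ≤ M, |Real.log (riskMean P T Z β u)| ≤ K := by
  obtain ⟨κ, hκ, hle⟩ := h.exists_riskMean_lower hM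
  refine ⟨|Real.log κ| + ∫ ω, envelope beta0 ρ (Z ω) ∂P, fun β hβ u hu => ?_⟩
  have h1 := hle β hβ u hu
  have h2 : riskMean P T Z β u ≤ ∫ ω, envelope beta0 ρ (Z ω) ∂P :=
    (setIntegral_le_integral (h.integrable_exp hβ) (ae_of_all _ fun _ =>
      (Real.exp_pos _).le)).trans (integral_mono (h.integrable_exp hβ) h.integrable_envelope
        fun ω => exp_inner_le_envelope hβ _)
  have h3 := Real.log_le_log hκ h1
  have h4 := Real.log_le_sub_one_of_pos (hκ.trans_le h1)
  rw [abs_le]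
  constructor
  · linarith [neg_abs_le (Real.log κ), hκ.trans_le (h1.trans h2)]
  · linarith [abs_nonneg (Real.log κ)]

theorem integrableOn_logRatio [IsFiniteMeasure m] (h : EventModel P T E Z m beta0 ρ τ)
    {β : Cov p} (hβ : ‖β - beta0‖ ≤ ρ) {M : ℝ} (hM : M < τ) :
    IntegrableOn (fun ω => logRatio P T Z beta0 β (T ω) (Z ω)) (E ∩ {ω | T ω ≤ M}) P := by
  have hZ := h.measurable_Z
  have hT := h.measurable_T
  obtain ⟨K, hK⟩ := h.exists_abs_log_riskMean_le hM
  have hdom : IntegrableOn (fun ω => ρ * (1 + ‖Z ω‖) + (K + K)) (E ∩ {ω | T ω ≤ M}) P :=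
    ((h.integrableOn_norm.mono_set inter_subset_left).const_mul ρ).add
      (integrable_const _)
  refine hdom.mono' (h.measurable_logRatio hβ).aestronglyMeasurable ?_
  filter_upwards [ae_restrict_mem (h.measurableSet_E.inter (h.measurableSet_le M))] with ω hω
  have h1 := hK β hβ (T ω) hω.2
  have h2 := hK beta0 (by simpa using h.rho_pos.le) (T ω) hω.2
  have h3 := (abs_real_inner_le_norm (β - beta0) (Z ω)).trans
    (mul_le_mul_of_nonneg_right hβ (norm_nonneg (Z ω)))
  rw [logRatio, Real.norm_eq_abs]
  refine (abs_add_le _ _).trans (add_le_add ((abs_sub _ _).trans (add_le_add h3 h1)) h2 |>.trans ?_)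
  linarith [h.rho_pos]

theorem exp_logRatio (h : EventModel P T E Z m beta0 ρ τ) {β : Cov p} (hβ : ‖β - beta0‖ ≤ ρ)
    {u : ℝ} (hu : u < τ) (z : Cov p) :
    Real.exp (logRatio P T Z beta0 β u z) =
      Real.exp (inner ℝ (β - beta0) z) * ((riskMean P T Z β u)⁻¹ * riskMean P T Z beta0 u) := by
  have h0 : ‖beta0 - beta0‖ ≤ ρ := by simpa using h.rho_pos.le
  rw [logRatio, Real.exp_add, Real.exp_sub, Real.exp_log (h.riskMean_pos hβ hu),
    Real.exp_log (h.riskMean_pos h0 hu), div_eq_mul_inv, mul_assoc]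

theorem lintegral_event_eq (h : EventModel P T E Z m beta0 ρ τ) (M : ℝ) :
    P (E ∩ {ω | T ω ≤ M}) = ∫⁻ u in Iic M, ENNReal.ofReal (riskMean P T Z beta0 u) ∂m := by
  have h0 : ‖beta0 - beta0‖ ≤ ρ := by simpa using h.rho_pos.le
  have key := h.lintegral_event_exp h0 (w := (Iic M).indicator 1)
    (measurable_one.indicator measurableSet_Iic)
  rw [← lintegral_indicator measurableSet_Iic]
  have e : ∀ u, ENNReal.ofReal (riskMean P T Z beta0 u) * (Iic M).indicator 1 u =
      (Iic M).indicator (fun u => ENNReal.ofReal (riskMean P T Z beta0 u)) u := fun u => by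
    by_cases hu : u ≤ M <;> simp [hu]
  simp_rw [e] at key
  rw [← key, inter_comm, ← Measure.restrict_apply (h.measurableSet_le M),
    ← lintegral_indicator_one (h.measurableSet_le M)]
  refine lintegral_congr fun ω => ?_
  simp only [sub_self, inner_zero_left, Real.exp_zero, ENNReal.ofReal_one, one_mul]
  rfl

/-- The likelihood ratio of an event has mean one. -/
theorem lintegral_exp_logRatio (h : EventModel P T E Z m beta0 ρ τ) {β : Cov p}
    (hβ : ‖β - beta0‖ ≤ ρ) {M : ℝ} (hM : M < τ) :
    ∫⁻ ω in E ∩ {ω | T ω ≤ M},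
      ENNReal.ofReal (Real.exp (logRatio P T Z beta0 β (T ω) (Z ω))) ∂P =
        P (E ∩ {ω | T ω ≤ M}) := by
  have h1 := (h.continuous_riskMean hβ).measurable
  have h2 := (h.continuous_riskMean (β := beta0) (by simpa using h.rho_pos.le)).measurable
  have hw : Measurable ((Iic M).indicator fun u =>
      ENNReal.ofReal ((riskMean P T Z β u)⁻¹ * riskMean P T Z beta0 u)) :=
    Measurable.indicator (by fun_prop) measurableSet_Iic
  have key := h.lintegral_event_exp hβ hw
  rw [h.lintegral_event_eq, ← lintegral_indicator measurableSet_Iic, inter_comm,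
    ← Measure.restrict_restrict (h.measurableSet_le M), ← lintegral_indicator (h.measurableSet_le M)]
  refine Eq.trans (lintegral_congr fun ω => ?_) (key.trans (lintegral_congr fun u => ?_))
  · by_cases hω : T ω ≤ M
    · rw [indicator_of_mem (show ω ∈ {ω | T ω ≤ M} from hω), indicator_of_mem (mem_Iic.2 hω),
        h.exp_logRatio hβ (hω.trans_lt hM), ENNReal.ofReal_mul (Real.exp_pos _).le]
    · simp [hω]
  · by_cases hu : u ≤ M
    · rw [indicator_of_mem (mem_Iic.2 hu), indicator_of_mem (mem_Iic.2 hu),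
        ← ENNReal.ofReal_mul (h.riskMean_pos hβ (hu.trans_lt hM)).le,
        mul_inv_cancel_left₀ (h.riskMean_pos hβ (hu.trans_lt hM)).ne']
    · simp [hu]

/-- The population log likelihood ratio is negative away from `beta0`, unless the difference does
not affect the risk sets at events. -/
theorem exists_integral_logRatio_le [IsFiniteMeasure m] (h : EventModel P T E Z m beta0 ρ τ)
    (hId : ∀ c : Cov p, (∀ᵐ ω ∂P, ω ∈ E → inner ℝ c (Z ω) = 1) → ∀ᵐ ω ∂P, ω ∉ E) {β : Cov p}
    (hβ : ‖β - beta0‖ ≤ ρ)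
    (hN : ¬ ∀ᵐ ω ∂P, m (Iic (T ω)) ≠ 0 → inner ℝ (β - beta0) (Z ω) = 0) :
    ∃ M₀ < τ, ∃ δ > 0, ∀ M, M₀ ≤ M → M < τ →
      ∫ ω in E ∩ {ω | T ω ≤ M}, logRatio P T Z beta0 β (T ω) (Z ω) ∂P ≤ -δ := by
  have hZ := h.measurable_Z
  have hT := h.measurable_T
  obtain ⟨r, hr⟩ : ∃ r : Ω → ℝ, ∀ ω, r ω = logRatio P T Z beta0 β (T ω) (Z ω) :=
    ⟨_, fun _ => rfl⟩
  obtain ⟨f, hf⟩ : ∃ f : Ω → ℝ, ∀ ω, f ω = Real.exp (r ω) - 1 - r ω := ⟨_, fun _ => rfl⟩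
  have hrm : Measurable r := by
    rw [funext hr]
    exact h.measurable_logRatio hβ
  have hS : ∀ M, MeasurableSet (E ∩ {ω | T ω ≤ M}) := fun M =>
    h.measurableSet_E.inter (h.measurableSet_le M)
  have hf0 : ∀ ω, 0 ≤ f ω := fun ω => by
    rw [hf]
    linarith [Real.add_one_le_exp (r ω)]
  have hgap : ∀ M < τ, IntegrableOn f (E ∩ {ω | T ω ≤ M}) P ∧
      ∫ ω in E ∩ {ω | T ω ≤ M}, r ω ∂P = -∫ ω in E ∩ {ω | T ω ≤ M}, f ω ∂P := by
    intro M hM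
    rw [funext hf]
    refine setIntegral_eq_neg_of_lintegral_exp hrm ?_ ?_
    · rw [funext hr]
      exact h.integrableOn_logRatio hβ hM
    · simp_rw [hr]
      exact h.lintegral_exp_logRatio hβ hM
  simp_rw [← hr]
  -- The gap integral of f = exp r - 1 - r grows with the truncation time, so the δ found at M₀
  -- serves all later M. If it never becomes positive, then r = 0 on events, which expresses (β -
  -- β₀)'Z as a function of T.
  by_cases hex : ∃ M₀ < τ, 0 < ∫ ω in E ∩ {ω | T ω ≤ M₀}, f ω ∂P
  · obtain ⟨M₀, hM₀, hpos⟩ := hex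
    refine ⟨M₀, hM₀, _, hpos, fun M hM hMτ => ?_⟩
    rw [(hgap M hMτ).2]
    refine neg_le_neg (setIntegral_mono_set (hgap M hMτ).1 (ae_of_all _ hf0)
      (Eventually.of_forall ?_))
    exact fun ω hω => ⟨hω.1, le_trans hω.2 hM⟩
  · push Not at hex
    exfalso
    refine hN (h.inner_eq_zero_of_event hId
      (a := fun u => Real.log (riskMean P T Z β u) - Real.log (riskMean P T Z beta0 u)) ?_ ?_)
    · have h1 := (h.continuous_riskMean hβ).measurable
      have h2 := (h.continuous_riskMean (β := beta0) (by simpa using h.rho_pos.le)).measurable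
      fun_prop
    · have hz : ∀ k : ℕ, ∀ᵐ ω ∂P, ω ∈ E ∩ {ω | T ω ≤ τ - 1 / ((k : ℝ) + 1)} → f ω = 0 := by
        intro k
        have hk : τ - 1 / ((k : ℝ) + 1) < τ := sub_lt_self _ (by positivity)
        have h0 := le_antisymm (hex _ hk) (setIntegral_nonneg (hS _) fun ω _ => hf0 ω)
        rw [setIntegral_eq_zero_iff_of_nonneg_ae (ae_of_all _ hf0) (hgap _ hk).1] at h0
        exact (ae_restrict_iff' (hS _)).1 h0
      filter_upwards [ae_all_iff.2 hz, h.ae_lt] with ω hω hlt hE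
      obtain ⟨k, hk⟩ := exists_nat_one_div_lt (sub_pos.2 hlt)
      have h0 := hω k ⟨hE, (by linarith : T ω ≤ _)⟩
      have hr0 : r ω = 0 := by
        by_contra hne
        have := Real.add_one_lt_exp hne
        rw [hf] at h0
        linarith
      rw [hr, logRatio] at hr0
      linarith

/-- The mean of the inverse weights of the events is the cumulative hazard. -/
theorem integral_inv_riskMean [IsFiniteMeasure m] (h : EventModel P T E Z m beta0 ρ τ) {x : ℝ}
    (hx : x < τ) :
    ∫ ω in E ∩ {ω | T ω ≤ x}, (riskMean P T Z beta0 (T ω))⁻¹ ∂P = m.real (Iic x) := by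
  have h0 : ‖beta0 - beta0‖ ≤ ρ := by simpa using h.rho_pos.le
  have h2 := (h.continuous_riskMean h0).measurable
  have hT := h.measurable_T
  have hw : Measurable ((Iic x).indicator fun u => ENNReal.ofReal (riskMean P T Z beta0 u)⁻¹) :=
    Measurable.indicator (by fun_prop) measurableSet_Iic
  have key := h.lintegral_event_exp h0 hw
  have hnn : ∀ u, 0 ≤ riskMean P T Z beta0 u := fun u =>
    integral_nonneg fun _ => (Real.exp_pos _).le
  rw [integral_eq_lintegral_of_nonneg_ae (ae_of_all _ fun ω => inv_nonneg.2 (hnn _))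
    (h2.comp hT).inv.aestronglyMeasurable, inter_comm,
    ← Measure.restrict_restrict (h.measurableSet_le x),
    ← lintegral_indicator (h.measurableSet_le x), Measure.real]
  congr 1
  rw [← lintegral_indicator_one measurableSet_Iic]
  refine Eq.trans (lintegral_congr fun ω => ?_) (key.trans (lintegral_congr fun u => ?_))
  · simp only [sub_self, inner_zero_left, Real.exp_zero, ENNReal.ofReal_one, one_mul]
    rfl
  · by_cases hu : u ≤ x
    · rw [indicator_of_mem (mem_Iic.2 hu), indicator_of_mem (mem_Iic.2 hu),
        ← ENNReal.ofReal_mul (hnn u), mul_inv_cancel₀ (h.riskMean_pos h0 (hu.trans_lt hx)).ne']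
      simp
    · simp [hu]

theorem tendsto_setIntegral_tail (h : EventModel P T E Z m beta0 ρ τ) {φ : Ω → ℝ}
    (hφ : IntegrableOn φ E P) :
    Tendsto (fun k : ℕ => ∫ ω in E ∩ {ω | τ - 1 / ((k : ℝ) + 1) < T ω}, φ ω ∂P) atTop (𝓝 0) := by
  have hS : ∀ k : ℕ, MeasurableSet (E ∩ {ω | τ - 1 / ((k : ℝ) + 1) < T ω}) := fun k =>
    h.measurableSet_E.inter (measurableSet_lt measurable_const h.measurable_T)
  have hanti : Antitone fun k : ℕ => E ∩ {ω | τ - 1 / ((k : ℝ) + 1) < T ω} := by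
    intro k l hkl ω hω
    refine ⟨hω.1, lt_of_le_of_lt ?_ (show τ - 1 / ((l : ℝ) + 1) < T ω from hω.2)⟩
    exact sub_le_sub_left (Nat.one_div_le_one_div hkl) _
  have hlim := tendsto_setIntegral_of_antitone hS hanti ⟨0, hφ.mono_set inter_subset_left⟩
  have hnull : P (⋂ k : ℕ, E ∩ {ω | τ - 1 / ((k : ℝ) + 1) < T ω}) = 0 := by
    refine measure_eq_zero_iff_ae_notMem.2 ?_
    filter_upwards [h.ae_lt] with ω hω hmem
    obtain ⟨k, hk⟩ := exists_nat_one_div_lt (sub_pos.2 hω)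
    have : τ - 1 / ((k : ℝ) + 1) < T ω := (mem_iInter.1 hmem k).2
    linarith
  rwa [setIntegral_measure_zero _ hnull] at hlim

end EventModel

end

noncomputable section

variable {p : ℕ} {Ω : Type*} [MeasurableSpace Ω] {P : Measure Ω} [IsProbabilityMeasure P]
  {T : Ω → ℝ} {E : Set Ω} {Z : Ω → Cov p} {m : Measure ℝ} {beta0 : Cov p} {ρ τ M : ℝ}
  {t : ℕ → ℝ} {d : ℕ → Bool} {z : ℕ → Cov p}

/-! ### Uniform convergence of compositions and of averages -/

theorem abs_log_sub_log_le {κ a b : ℝ} (hκ : 0 < κ) (ha : κ ≤ a) (hb : κ ≤ b) :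
    |Real.log a - Real.log b| ≤ κ⁻¹ * |a - b| := by
  wlog hab : b ≤ a generalizing a b
  · rw [abs_sub_comm, abs_sub_comm a]
    exact this hb ha (le_of_not_ge hab)
  have hb0 := hκ.trans_le hb
  have ha0 := hκ.trans_le ha
  rw [abs_of_nonneg (sub_nonneg.2 (Real.log_le_log hb0 hab)), abs_of_nonneg (sub_nonneg.2 hab),
    ← Real.log_div ha0.ne' hb0.ne']
  refine (Real.log_le_sub_one_of_pos (div_pos ha0 hb0)).trans ?_
  have : a / b - 1 = b⁻¹ * (a - b) := by field_simp
  rw [this]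
  exact mul_le_mul_of_nonneg_right (inv_anti₀ hκ hb) (sub_nonneg.2 hab)

theorem abs_inv_sub_inv_le {κ a b : ℝ} (hκ : 0 < κ) (ha : κ ≤ a) (hb : κ ≤ b) :
    |a⁻¹ - b⁻¹| ≤ (κ⁻¹ * κ⁻¹) * |a - b| := by
  have hb0 := hκ.trans_le hb
  have ha0 := hκ.trans_le ha
  have : a⁻¹ - b⁻¹ = (a⁻¹ * b⁻¹) * (b - a) := by field_simp
  rw [this, abs_mul, abs_of_pos (mul_pos (inv_pos.2 ha0) (inv_pos.2 hb0)), abs_sub_comm b]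
  refine mul_le_mul_of_nonneg_right ?_ (abs_nonneg _)
  exact mul_le_mul (inv_anti₀ hκ ha) (inv_anti₀ hκ hb) (inv_pos.2 hb0).le (inv_pos.2 hκ).le

/-- Once the functions are within κ/2 of a limit bounded below by κ, all values lie above κ/2, so φ
(a logarithm or an inverse in the applications) has to be Lipschitz only there. -/
theorem tendstoUniformlyOn_comp_of_lipschitz {ι : Type*} {F : Filter ι} {f : ι → ℝ → ℝ}
    {s : ℝ → ℝ} {K : Set ℝ} (hf : TendstoUniformlyOn f s F K) {κ L : ℝ} (hκ : 0 < κ)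
    (hs : ∀ u ∈ K, κ ≤ s u) {φ : ℝ → ℝ}
    (hφ : ∀ a b, κ / 2 ≤ a → κ / 2 ≤ b → |φ a - φ b| ≤ L * |a - b|) :
    TendstoUniformlyOn (fun i u => φ (f i u)) (fun u => φ (s u)) F K := by
  rw [Metric.tendstoUniformlyOn_iff] at hf ⊢
  intro ε hε
  have hL : 0 < |L| + 1 := by positivity
  filter_upwards [hf (κ / 2) (by positivity), hf (ε / (|L| + 1)) (by positivity)] with i h1 h2 u hu
  have a1 := h1 u hu
  have a2 := h2 u hu
  rw [Real.dist_eq] at a1 a2 ⊢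
  have a3 := (abs_lt.1 a1).2
  have hsu := hs u hu
  refine (hφ _ _ (by linarith) (by linarith)).trans_lt ?_
  rw [lt_div_iff₀ hL] at a2
  nlinarith [le_abs_self L, abs_nonneg (s u - f i u)]

theorem abs_sum_div_le {n : ℕ} {A : Finset ℕ} (hA : A ⊆ Finset.range n) {g : ℕ → ℝ} {ε : ℝ}
    (hε : 0 ≤ ε) (hg : ∀ j ∈ A, |g j| ≤ ε) : |(∑ j ∈ A, g j) / n| ≤ ε := by
  rw [abs_div, Nat.abs_cast]
  refine div_le_of_le_mul₀ (Nat.cast_nonneg n) hε ?_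
  calc |∑ j ∈ A, g j| ≤ ∑ j ∈ A, |g j| := Finset.abs_sum_le_sum_abs _ _
    _ ≤ A.card • ε := Finset.sum_le_card_nsmul _ _ _ hg
    _ ≤ ε * n := by
        rw [nsmul_eq_mul, mul_comm]
        refine mul_le_mul_of_nonneg_left ?_ hε
        exact_mod_cast (Finset.card_le_card hA).trans (Finset.card_range n).le

theorem tendsto_sum_div_of_uniform {ι : Type*} {F : Filter ι} {f : ι → ℝ → ℝ} {s : ℝ → ℝ}
    {K : Set ℝ} (hf : TendstoUniformlyOn f s F K) (N : ι → ℕ) {A : ι → Finset ℕ}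
    (hA : ∀ i, A i ⊆ Finset.range (N i)) (hK : ∀ i, ∀ j ∈ A i, t j ∈ K) :
    Tendsto (fun i => (∑ j ∈ A i, (f i (t j) - s (t j))) / N i) F (𝓝 0) := by
  rw [Metric.tendsto_nhds]
  intro ε hε
  filter_upwards [Metric.tendstoUniformlyOn_iff.1 hf (ε / 2) (by positivity)] with i hi
  rw [Real.dist_eq, sub_zero]
  refine (abs_sum_div_le (hA i) (by positivity : (0 : ℝ) ≤ ε / 2) fun j hj => ?_).trans_lt
    (by linarith)
  have := hi _ (hK i j hj)
  rw [Real.dist_eq, abs_sub_comm] at this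
  exact this.le

/-! ### Regular samples -/

/-- Thresholds that increase to the end point of the support. -/
def threshold (τ : ℝ) (k : ℕ) : ℝ := τ - 1 / ((k : ℝ) + 1)

theorem threshold_lt (τ : ℝ) (k : ℕ) : threshold τ k < τ := sub_lt_self _ (by positivity)

/-- The directions that do not affect the risk sets at event times. -/
def nullDirections (P : Measure Ω) (T : Ω → ℝ) (Z : Ω → Cov p) (m : Measure ℝ) :
    Submodule ℝ (Cov p) where
  carrier := {c | ∀ᵐ ω ∂P, m (Iic (T ω)) ≠ 0 → inner ℝ c (Z ω) = 0}
  add_mem' {a b} ha hb := by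
    change ∀ᵐ ω ∂P, m (Iic (T ω)) ≠ 0 → inner ℝ (a + b) (Z ω) = 0
    filter_upwards [ha, hb] with ω h1 h2 h
    rw [inner_add_left, h1 h, h2 h, add_zero]
  zero_mem' := ae_of_all _ fun ω _ => inner_zero_left _
  smul_mem' k a ha := by
    change ∀ᵐ ω ∂P, m (Iic (T ω)) ≠ 0 → inner ℝ (k • a) (Z ω) = 0
    filter_upwards [ha] with ω h1 h
    rw [inner_smul_left, h1 h, mul_zero]

/-- A realization of the sample on which the laws of large numbers hold that are used below. -/
structure IsRegularSample (P : Measure Ω) (T : Ω → ℝ) (E : Set Ω) (Z : Ω → Cov p) (m : Measure ℝ)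
    (beta0 : Cov p) (ρ τ M : ℝ) (t : ℕ → ℝ) (d : ℕ → Bool) (z : ℕ → Cov p) : Prop where
  nonneg : ∀ i, 0 ≤ t i
  risk : ∀ β, ‖β - beta0‖ ≤ ρ → ∀ q : ℚ,
    Tendsto (fun n : ℕ => riskSum t z n β q / n) atTop (𝓝 (riskMean P T Z β q))
  env : Tendsto (fun n : ℕ => (∑ i ∈ Finset.range n, envelope beta0 ρ (z i)) / n) atTop
    (𝓝 (∫ ω, envelope beta0 ρ (Z ω) ∂P))
  norm : Tendsto (fun n : ℕ => (∑ i ∈ Finset.range n with d i = true, (1 + ‖z i‖)) / n) atTop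
    (𝓝 (∫ ω in E, (1 + ‖Z ω‖) ∂P))
  tail_env : ∀ k, Tendsto (fun n : ℕ => (∑ i ∈ Finset.range n with
      d i = true ∧ threshold τ k < t i, envelope beta0 ρ (z i)) / n) atTop
    (𝓝 (∫ ω in E ∩ {ω | threshold τ k < T ω}, envelope beta0 ρ (Z ω) ∂P))
  tail_norm : ∀ k, Tendsto (fun n : ℕ => (∑ i ∈ Finset.range n with
      d i = true ∧ threshold τ k < t i, (1 + ‖z i‖)) / n) atTop
    (𝓝 (∫ ω in E ∩ {ω | threshold τ k < T ω}, (1 + ‖Z ω‖) ∂P))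
  ratio : ∀ k β, ‖β - beta0‖ ≤ ρ → Tendsto (fun n : ℕ => (∑ i ∈ Finset.range n with
      d i = true ∧ t i ≤ threshold τ k, EventModel.logRatio P T Z beta0 β (t i) (z i)) / n) atTop
    (𝓝 (∫ ω in E ∩ {ω | T ω ≤ threshold τ k},
      EventModel.logRatio P T Z beta0 β (T ω) (Z ω) ∂P))
  hazard : ∀ q : ℚ, Tendsto (fun n : ℕ => (∑ i ∈ Finset.range n with
      d i = true ∧ t i ≤ min (q : ℝ) M, (riskMean P T Z beta0 (t i))⁻¹) / n) atTop
    (𝓝 (∫ ω in E ∩ {ω | T ω ≤ min (q : ℝ) M}, (riskMean P T Z beta0 (T ω))⁻¹ ∂P))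
  inner_eq_zero : ∀ c ∈ nullDirections P T Z m, ∀ i j, d i = true → t i ≤ t j →
    inner ℝ c (z j) = (0 : ℝ)

theorem abs_riskSum_sub_le {β β' : Cov p} (hβ : ‖β - beta0‖ ≤ ρ) (hβ' : ‖β' - beta0‖ ≤ ρ)
    (n : ℕ) (u : ℝ) :
    |riskSum t z n β u / n - riskSum t z n β' u / n| ≤
      ‖β - β'‖ * ((∑ i ∈ Finset.range n, envelope beta0 ρ (z i)) / n) := by
  rw [← sub_div, abs_div, Nat.abs_cast, ← mul_div_assoc]
  refine div_le_div_of_nonneg_right ?_ (Nat.cast_nonneg n)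
  rw [riskSum, riskSum, ← Finset.sum_sub_distrib, Finset.mul_sum]
  refine (Finset.abs_sum_le_sum_abs _ _).trans ((Finset.sum_le_sum fun i _ =>
    abs_exp_inner_sub_le hβ hβ' (z i)).trans ?_)
  exact Finset.sum_le_sum_of_subset_of_nonneg (Finset.filter_subset _ _) fun i _ _ =>
    mul_nonneg (norm_nonneg _) (envelope_pos _ _ _).le

namespace IsRegularSample

/-- The coefficients may vary along the filter: the envelope average bounds the change from b to β,
and Pólya's theorem upgrades convergence at rational times. -/
theorem tendstoUniformlyOn_risk (R : IsRegularSample P T E Z m beta0 ρ τ M t d z)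
    (h : EventModel P T E Z m beta0 ρ τ) {ι : Type*} {F : Filter ι} {N : ι → ℕ} {b : ι → Cov p}
    {β : Cov p} (hβ : ‖β - beta0‖ < ρ) (hN : Tendsto N F atTop) (hb : Tendsto b F (𝓝 β))
    {K : Set ℝ} (hK : IsCompact K) :
    TendstoUniformlyOn (fun i u => riskSum t z (N i) (b i) u / N i) (riskMean P T Z β) F K := by
  have hanti : ∀ i, Antitone fun u => riskSum t z (N i) (b i) u / N i := fun i u v huv =>
    div_le_div_of_nonneg_right (riskSum_antitone t z _ _ huv) (Nat.cast_nonneg _)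
  refine tendstoUniformlyOn_of_antitone hanti (h.continuous_riskMean hβ.le) ?_ hK
  intro q
  have h1 := (R.risk β hβ.le q).comp hN
  have h2 : Tendsto (fun i => ‖b i - β‖ *
      ((∑ j ∈ Finset.range (N i), envelope beta0 ρ (z j)) / N i)) F (𝓝 0) := by
    have := (tendsto_iff_norm_sub_tendsto_zero.1 hb).mul (R.env.comp hN)
    simpa only [zero_mul] using! this
  have hnear : ∀ᶠ i in F, ‖b i - beta0‖ ≤ ρ := by
    have := hb (Metric.isOpen_ball.mem_nhds (mem_ball_iff_norm.2 hβ))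
    filter_upwards [this] with i hi
    exact (mem_ball_iff_norm.1 hi).le
  have h3 : Tendsto (fun i => riskSum t z (N i) (b i) q / N i - riskSum t z (N i) β q / N i) F
      (𝓝 0) := by
    refine squeeze_zero_norm' ?_ h2
    filter_upwards [hnear] with i hi
    exact abs_riskSum_sub_le hi hβ.le _ _
  simpa [Function.comp_def] using h3.add h1

/-- Near a point that is not equivalent to `beta0` the likelihood eventually is smaller than at
`beta0`. -/
theorem eventually_partialLikelihood_lt [IsFiniteMeasure m]
    (R : IsRegularSample P T E Z m beta0 ρ τ M t d z) (h : EventModel P T E Z m beta0 ρ τ)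
    (hId : ∀ c : Cov p, (∀ᵐ ω ∂P, ω ∈ E → inner ℝ c (Z ω) = 1) → ∀ᵐ ω ∂P, ω ∉ E) {β : Cov p}
    (hβ : ‖β - beta0‖ < ρ) (hN : β - beta0 ∉ nullDirections P T Z m) :
    ∀ᶠ x : ℕ × Cov p in atTop ×ˢ 𝓝 β,
      partialLikelihood t d z x.1 x.2 < partialLikelihood t d z x.1 beta0 := by
  have h0 : ‖beta0 - beta0‖ < ρ := by simpa using h.rho_pos
  obtain ⟨M₀, hM₀, δ, hδ, hle⟩ := h.exists_integral_logRatio_le hId hβ.le hN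
  set e := ∫ ω, envelope beta0 ρ (Z ω) ∂P with he
  -- An eventual bound for ‖b‖ + ‖β₀‖ + S in `sum_tail_log_le`: b is within 1 of β, and the
  -- normalized risk sums at β₀ are below e + 1.
  set c := ‖β‖ + 1 + ‖beta0‖ + (e + 1) with hc
  have hta := h.tendsto_setIntegral_tail (φ := fun ω => envelope beta0 ρ (Z ω))
    h.integrable_envelope.integrableOn
  have htb := h.tendsto_setIntegral_tail h.integrableOn_norm
  have htail : Tendsto (fun k : ℕ =>
      4 * √(∫ ω in E ∩ {ω | threshold τ k < T ω}, envelope beta0 ρ (Z ω) ∂P) +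
        c * ∫ ω in E ∩ {ω | threshold τ k < T ω}, (1 + ‖Z ω‖) ∂P) atTop (𝓝 0) := by
    have := ((hta.sqrt).const_mul 4).add (htb.const_mul c)
    simpa only [Real.sqrt_zero, mul_zero, add_zero] using! this
  have hthr : Tendsto (threshold τ) atTop (𝓝 τ) := by
    have := (tendsto_const_nhds (x := τ)).sub
      (tendsto_one_div_add_atTop_nhds_zero_nat (𝕜 := ℝ))
    simpa only [sub_zero] using! this
  -- The truncation is late enough for the limiting tail bound to be below δ, and late enough for
  -- the truncated mean to be at most -δ. The latter holds uniformly beyond M₀, so δ is fixed before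
  -- k.
  obtain ⟨k, hk1, hk2⟩ := ((htail.eventually (gt_mem_nhds hδ)).and
    (hthr.eventually (lt_mem_nhds hM₀))).exists
  set u := threshold τ k with hu
  have huτ : u < τ := threshold_lt τ k
  -- Sample size and coefficient move jointly, so that the conclusion holds on a neighborhood of β
  -- for all large n and can be combined with compactness.
  set F : Filter (ℕ × Cov p) := atTop ×ˢ 𝓝 β with hF
  have F1 : Tendsto (fun x : ℕ × Cov p => x.1) F atTop := tendsto_fst
  have F2 : Tendsto (fun x : ℕ × Cov p => x.2) F (𝓝 β) := tendsto_snd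
  obtain ⟨κ, hκ, hκle⟩ := h.exists_riskMean_lower huτ
  have logunif : ∀ {b : ℕ × Cov p → Cov p} {β' : Cov p}, ‖β' - beta0‖ < ρ →
      Tendsto b F (𝓝 β') → Tendsto (fun x : ℕ × Cov p =>
        (∑ j ∈ Finset.range x.1 with d j = true ∧ t j ≤ u,
          (Real.log (riskSum t z x.1 (b x) (t j) / x.1) - Real.log (riskMean P T Z β' (t j)))) /
            x.1) F (𝓝 0) := by
    intro b β' hβ' hb
    have hunif := tendstoUniformlyOn_comp_of_lipschitz (φ := Real.log)
      (R.tendstoUniformlyOn_risk h hβ' F1 hb (isCompact_Icc (a := 0) (b := u))) hκ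
      (fun v hv => hκle β' hβ'.le v hv.2)
      (fun a a' ha ha' => abs_log_sub_log_le (by positivity) ha ha')
    exact tendsto_sum_div_of_uniform hunif (fun x => x.1)
      (A := fun x => (Finset.range x.1).filter fun j => d j = true ∧ t j ≤ u)
      (fun x => Finset.filter_subset _ _)
      fun x j hj => ⟨R.nonneg j, (Finset.mem_filter.1 hj).2.2⟩
  have l1 := logunif hβ F2
  have l2 := logunif h0 (tendsto_const_nhds (x := beta0))
  have l3 : Tendsto (fun x : ℕ × Cov p => (∑ j ∈ Finset.range x.1 with d j = true ∧ t j ≤ u,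
      (inner ℝ (x.2 - β) (z j) : ℝ)) / x.1) F (𝓝 0) := by
    have h2 : Tendsto (fun x : ℕ × Cov p => ‖x.2 - β‖ *
        ((∑ j ∈ Finset.range x.1 with d j = true, (1 + ‖z j‖)) / x.1)) F (𝓝 0) := by
      have := (tendsto_iff_norm_sub_tendsto_zero.1 F2).mul (R.norm.comp F1)
      simpa only [zero_mul] using! this
    refine squeeze_zero_norm (fun x => ?_) h2
    rw [norm_div, Real.norm_natCast, ← mul_div_assoc]
    refine div_le_div_of_nonneg_right ?_ (Nat.cast_nonneg _)
    rw [Finset.mul_sum]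
    refine (norm_sum_le _ _).trans ((Finset.sum_le_sum fun j _ =>
      (abs_real_inner_le_norm (x.2 - β) (z j)).trans (mul_le_mul_of_nonneg_left
        (by linarith : ‖z j‖ ≤ 1 + ‖z j‖) (norm_nonneg _))).trans ?_)
    refine Finset.sum_le_sum_of_subset_of_nonneg (fun j hj => ?_) fun j _ _ => by positivity
    rw [Finset.mem_filter] at hj ⊢
    exact ⟨hj.1, hj.2.1⟩
  have l4 := (R.ratio k β hβ.le).comp F1
  have ltr := (((l4.add l3).sub l1).add l2)
  have hneg : (∫ ω in E ∩ {ω | T ω ≤ u}, EventModel.logRatio P T Z beta0 β (T ω) (Z ω) ∂P) + 0 - 0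
      + 0 ≤ -δ := by
    rw [add_zero, sub_zero, add_zero]
    exact hle u hk2.le huτ
  have ltl := ((((R.tail_env k).comp F1).sqrt).const_mul 4).add
    (((R.tail_norm k).comp F1).const_mul c)
  have hsum := ltr.add ltl
  have hlt := Tendsto.eventually_lt_const (u := (0 : ℝ)) (by linarith only [hneg, hk1]) hsum
  have hnear : ∀ᶠ x in F, ‖x.2 - beta0‖ ≤ ρ ∧ ‖x.2‖ ≤ ‖β‖ + 1 := by
    have a1 := F2 (Metric.isOpen_ball.mem_nhds (mem_ball_iff_norm.2 hβ))
    have a2 := Tendsto.eventually_lt_const (u := ‖β‖ + 1) (by linarith) F2.norm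
    filter_upwards [a1, a2] with x hx hx2
    exact ⟨(mem_ball_iff_norm.1 hx).le, hx2.le⟩
  have henv : ∀ᶠ x in F, (∑ i ∈ Finset.range x.1, envelope beta0 ρ (z i)) / x.1 ≤ e + 1 := by
    filter_upwards [Tendsto.eventually_lt_const (u := e + 1) (by linarith) (R.env.comp F1)] with x hx
    exact le_of_lt hx
  filter_upwards [hlt, hnear, henv, F1.eventually (eventually_gt_atTop 0)] with x hx hx2 hx3 hx4
  obtain ⟨n, b⟩ := x
  simp only [Function.comp_apply] at hx hx2 hx3 hx4
  have hn : (0 : ℝ) < n := by exact_mod_cast hx4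
  have hS : ∀ v, riskSum t z n beta0 v / n ≤ e + 1 := by
    intro v
    refine le_trans (div_le_div_of_nonneg_right ?_ hn.le) hx3
    exact (Finset.sum_le_sum fun i _ => exp_inner_le_envelope h0.le (z i)).trans
      (Finset.sum_le_sum_of_subset_of_nonneg (Finset.filter_subset _ _) fun i _ _ =>
        (envelope_pos _ _ _).le)
  have htl := sum_tail_log_le t z n b beta0
    ((Finset.range n).filter fun i => d i = true ∧ u < t i) (Finset.filter_subset _ _)
    (S := e + 1) (fun i _ => hS _)
  have hmono : 4 * √((∑ i ∈ Finset.range n with d i = true ∧ u < t i,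
      Real.exp (inner ℝ b (z i))) / n) ≤ 4 * √((∑ i ∈ Finset.range n with
        d i = true ∧ u < t i, envelope beta0 ρ (z i)) / n) := by
    gcongr with i
    exact exp_inner_le_envelope hx2.1 (z i)
  have hmono2 : (‖b‖ + ‖beta0‖ + (e + 1)) * ((∑ i ∈ Finset.range n with
      d i = true ∧ u < t i, (1 + ‖z i‖)) / n) ≤ c * ((∑ i ∈ Finset.range n with
      d i = true ∧ u < t i, (1 + ‖z i‖)) / n) := by
    refine mul_le_mul_of_nonneg_right (by rw [hc]; linarith [hx2.2]) ?_
    exact div_nonneg (Finset.sum_nonneg fun i _ => by positivity) hn.le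
  have hsplit := log_partialLikelihood_sub t d z n b beta0
  rw [← Finset.sum_filter_add_sum_filter_not _ (fun i => t i ≤ u), Finset.filter_filter,
    Finset.filter_filter] at hsplit
  simp only [not_le] at hsplit
  have htrunc : (∑ i ∈ Finset.range n with d i = true ∧ t i ≤ u,
      ((inner ℝ (b - beta0) (z i) : ℝ) - Real.log (riskSum t z n b (t i) / n) +
        Real.log (riskSum t z n beta0 (t i) / n))) / n =
      (∑ i ∈ Finset.range n with d i = true ∧ t i ≤ u,
        EventModel.logRatio P T Z beta0 β (t i) (z i)) / n +
      (∑ i ∈ Finset.range n with d i = true ∧ t i ≤ u, (inner ℝ (b - β) (z i) : ℝ)) / n -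
      (∑ i ∈ Finset.range n with d i = true ∧ t i ≤ u,
        (Real.log (riskSum t z n b (t i) / n) - Real.log (riskMean P T Z β (t i)))) / n +
      (∑ i ∈ Finset.range n with d i = true ∧ t i ≤ u,
        (Real.log (riskSum t z n beta0 (t i) / n) -
          Real.log (riskMean P T Z beta0 (t i)))) / n := by
    rw [← add_div, ← sub_div, ← add_div, ← Finset.sum_add_distrib, ← Finset.sum_sub_distrib,
      ← Finset.sum_add_distrib]
    congr 1
    refine Finset.sum_congr rfl fun i _ => ?_
    rw [EventModel.logRatio]
    simp only [inner_sub_left]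
    ring
  have hfin : (Real.log (partialLikelihood t d z n b) -
      Real.log (partialLikelihood t d z n beta0)) / n < 0 := by
    rw [hsplit, add_div, htrunc]
    linarith
  rw [div_lt_iff₀ hn, zero_mul, sub_neg] at hfin
  exact (Real.log_lt_log_iff (partialLikelihood_pos _ _ _ _ _)
    (partialLikelihood_pos _ _ _ _ _)).1 hfin

end IsRegularSample

end

noncomputable section

variable {p : ℕ} {Ω : Type*} [MeasurableSpace Ω] {P : Measure Ω} [IsProbabilityMeasure P]
  {T : Ω → ℝ} {E : Set Ω} {Z : Ω → Cov p} {m : Measure ℝ} {beta0 : Cov p} {ρ τ M : ℝ}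
  {t : ℕ → ℝ} {d : ℕ → Bool} {z : ℕ → Cov p}

/-! ### Localization of maximizers -/

/-- By concavity, a likelihood that is smaller on a sphere of a subspace than at its center is
smaller outside of it, too. -/
theorem partialLikelihood_lt_of_sphere {V : Submodule ℝ (Cov p)} {b : Cov p} {r : ℝ} (hr : 0 < r)
    {n : ℕ} (hsph : ∀ v ∈ V, ‖v‖ = r →
      partialLikelihood t d z n (b + v) < partialLikelihood t d z n b) {v : Cov p} (hv : v ∈ V)
    (hrv : r ≤ ‖v‖) : partialLikelihood t d z n (b + v) < partialLikelihood t d z n b := by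
  have hv0 : 0 < ‖v‖ := hr.trans_le hrv
  have hc0 : 0 < r / ‖v‖ := div_pos hr hv0
  have h1 := log_partialLikelihood_concave t d z n b v hc0.le ((div_le_one hv0).2 hrv)
  have h2 := hsph ((r / ‖v‖) • v) (V.smul_mem _ hv) (by
    rw [norm_smul, Real.norm_of_nonneg hc0.le, div_mul_cancel₀ _ hv0.ne'])
  have h3 := Real.log_lt_log (partialLikelihood_pos _ _ _ _ _) h2
  have h4 := neg_of_mul_neg_right (h1.trans_lt (sub_neg.2 h3)) hc0.le
  exact (Real.log_lt_log_iff (partialLikelihood_pos _ _ _ _ _)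
    (partialLikelihood_pos _ _ _ _ _)).1 (sub_neg.1 h4)

/-- Modulo π every coefficient can be taken in V. There the likelihood outside the ball is below
that at the center, so the maximum over the compact ball is global, and no maximizer projects to the
sphere or beyond. -/
theorem exists_isMaxPartialLikelihood {V : Submodule ℝ (Cov p)} {b : Cov p} {π : Cov p → Cov p}
    (hπ : ∀ v, π v ∈ V) {r : ℝ} (hr : 0 < r) {n : ℕ}
    (hcongr : ∀ v, partialLikelihood t d z n (b + v) = partialLikelihood t d z n (b + π v))
    (hsph : ∀ v ∈ V, ‖v‖ = r →
      partialLikelihood t d z n (b + v) < partialLikelihood t d z n b) :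
    (∃ b', IsMaxPartialLikelihood t d z n b') ∧
      ∀ b', IsMaxPartialLikelihood t d z n b' → ‖π (b' - b)‖ < r := by
  constructor
  · have hK : IsCompact ((V : Set (Cov p)) ∩ Metric.closedBall 0 r) :=
      (isCompact_closedBall 0 r).inter_left V.closed_of_finiteDimensional
    obtain ⟨v₀, hv₀, hmax⟩ := hK.exists_isMaxOn ⟨0, V.zero_mem, by simp [hr.le]⟩
      ((continuous_partialLikelihood t d z n).comp (continuous_const.add continuous_id)
        |>.continuousOn (s := _) : ContinuousOn (fun v => partialLikelihood t d z n (b + v)) _)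
    have h0 : partialLikelihood t d z n b ≤ partialLikelihood t d z n (b + v₀) := by
      have := hmax (show (0 : Cov p) ∈ _ from ⟨V.zero_mem, by simp [hr.le]⟩)
      simpa using this
    refine ⟨b + v₀, fun β => ?_⟩
    have e : partialLikelihood t d z n β = partialLikelihood t d z n (b + π (β - b)) := by
      rw [← hcongr, add_sub_cancel]
    rw [e]
    rcases le_or_gt ‖π (β - b)‖ r with hle | hgt
    · exact hmax (show π (β - b) ∈ _ from ⟨hπ _, by simpa using hle⟩)
    · exact (partialLikelihood_lt_of_sphere hr hsph (hπ _) hgt.le).le.trans h0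
  · intro b' hb'
    by_contra! hcon
    have h1 := partialLikelihood_lt_of_sphere hr hsph (hπ _) hcon
    rw [← hcongr, add_sub_cancel] at h1
    exact absurd (hb' b) (not_le.2 h1)

namespace IsRegularSample

/-- Replacing the coefficients by their component off the null directions, relative to `beta0`. -/
def normalize (P : Measure Ω) (T : Ω → ℝ) (Z : Ω → Cov p) (m : Measure ℝ) (v : Cov p) : Cov p :=
  (nullDirections P T Z m)ᗮ.starProjection v

theorem inner_normalize (R : IsRegularSample P T E Z m beta0 ρ τ M t d z) (v : Cov p) (i j : ℕ)
    (hi : d i = true) (hij : t i ≤ t j) :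
    inner ℝ (beta0 + v) (z j) = (inner ℝ (beta0 + normalize P T Z m v) (z j) : ℝ) := by
  have hmem : v - normalize P T Z m v ∈ nullDirections P T Z m := by
    have := Submodule.sub_starProjection_mem_orthogonal (K := (nullDirections P T Z m)ᗮ) v
    rwa [Submodule.orthogonal_orthogonal] at this
  have h := R.inner_eq_zero _ hmem i j hi hij
  rw [inner_sub_left] at h
  rw [inner_add_left, inner_add_left]
  linarith

/-- A nonzero vector orthogonal to the null directions is not a null direction, so each point of the
sphere has its local comparison with β₀; compactness of the sphere makes one threshold for n serve
all points. -/
theorem eventually_sphere [IsFiniteMeasure m]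
    (R : IsRegularSample P T E Z m beta0 ρ τ M t d z) (h : EventModel P T E Z m beta0 ρ τ)
    (hId : ∀ c : Cov p, (∀ᵐ ω ∂P, ω ∈ E → inner ℝ c (Z ω) = 1) → ∀ᵐ ω ∂P, ω ∉ E) {r : ℝ}
    (hr : 0 < r) (hrρ : r < ρ) :
    ∀ᶠ n in atTop, ∀ v ∈ (nullDirections P T Z m)ᗮ, ‖v‖ = r →
      partialLikelihood t d z n (beta0 + v) < partialLikelihood t d z n beta0 := by
  set V := (nullDirections P T Z m)ᗮ
  have hK : IsCompact ((V : Set (Cov p)) ∩ Metric.sphere 0 r) :=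
    (isCompact_sphere 0 r).inter_left V.closed_of_finiteDimensional
  have hloc : ∀ v ∈ (V : Set (Cov p)) ∩ Metric.sphere 0 r, ∀ᶠ x : ℕ × Cov p in atTop ×ˢ 𝓝 v,
      partialLikelihood t d z x.1 (beta0 + x.2) < partialLikelihood t d z x.1 beta0 := by
    rintro v ⟨hv, hvr⟩
    rw [mem_sphere_zero_iff_norm] at hvr
    have hN : (beta0 + v) - beta0 ∉ nullDirections P T Z m := by
      rw [add_sub_cancel_left]
      intro hmem
      have h0 : inner ℝ v v = (0 : ℝ) := (Submodule.mem_orthogonal _ _).1 hv v hmem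
      rw [inner_self_eq_zero] at h0
      rw [h0, norm_zero] at hvr
      exact hr.ne hvr
    have := R.eventually_partialLikelihood_lt h hId
      (by rw [add_sub_cancel_left, hvr]; exact hrρ) hN
    have hcont : Tendsto (fun x : ℕ × Cov p => (x.1, beta0 + x.2)) (atTop ×ˢ 𝓝 v)
        (atTop ×ˢ 𝓝 (beta0 + v)) :=
      tendsto_fst.prodMk (tendsto_const_nhds.add tendsto_snd)
    exact hcont.eventually this
  have hmem : {x : ℕ × Cov p | partialLikelihood t d z x.1 (beta0 + x.2) <
      partialLikelihood t d z x.1 beta0} ∈ atTop ×ˢ 𝓝ˢ ((V : Set (Cov p)) ∩ Metric.sphere 0 r) :=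
    hK.mem_prod_nhdsSet_of_forall hloc
  have hev : ∀ᶠ n in atTop, ∀ᶠ v in 𝓝ˢ ((V : Set (Cov p)) ∩ Metric.sphere 0 r),
      partialLikelihood t d z n (beta0 + v) < partialLikelihood t d z n beta0 :=
    Eventually.curry hmem
  filter_upwards [hev] with n hn v hv hvr
  exact hn.self_of_nhdsSet v ⟨hv, mem_sphere_zero_iff_norm.2 hvr⟩

/-- Consistency of the maximum partial likelihood estimator, up to null directions. -/
theorem tendsto_normalize [IsFiniteMeasure m]
    (R : IsRegularSample P T E Z m beta0 ρ τ M t d z) (h : EventModel P T E Z m beta0 ρ τ)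
    (hId : ∀ c : Cov p, (∀ᵐ ω ∂P, ω ∈ E → inner ℝ c (Z ω) = 1) → ∀ᵐ ω ∂P, ω ∉ E)
    {b : ℕ → Cov p} (hb : ∀ n, (∃ b', IsMaxPartialLikelihood t d z n b') →
      IsMaxPartialLikelihood t d z n (b n)) :
    Tendsto (fun n => beta0 + normalize P T Z m (b n - beta0)) atTop (𝓝 beta0) := by
  rw [Metric.tendsto_nhds]
  intro ε hε
  -- The cap ρ/2 keeps the sphere inside the ball on which the envelope controls the risk sums.
  have hr : 0 < min ε (ρ / 2) := lt_min hε (half_pos h.rho_pos)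
  filter_upwards [R.eventually_sphere h hId hr
    ((min_le_right _ _).trans_lt (half_lt_self h.rho_pos))] with n hn
  obtain ⟨hex, hloc⟩ := exists_isMaxPartialLikelihood (π := normalize P T Z m)
    (fun v => Submodule.starProjection_apply_mem _ v) hr
    (fun v => partialLikelihood_congr_of_inner_eq (R.inner_normalize v) n) hn
  rw [dist_eq_norm, add_sub_cancel_left]
  exact (hloc _ (hb n hex)).trans_le (min_le_left _ _)

/-- Uniform consistency of the Breslow estimator at consistent coefficients. -/
theorem tendstoUniformlyOn_breslow [IsFiniteMeasure m]
    (R : IsRegularSample P T E Z m beta0 ρ τ M t d z) (h : EventModel P T E Z m beta0 ρ τ)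
    (hM : M < τ) {b : ℕ → Cov p} (hb : Tendsto b atTop (𝓝 beta0)) :
    TendstoUniformlyOn (fun n x => breslow t d z n (b n) x) (fun x => m.real (Iic x)) atTop
      (Icc 0 M) := by
  have h0 : ‖beta0 - beta0‖ < ρ := by simpa using h.rho_pos
  obtain ⟨κ, hκ, hκle⟩ := h.exists_riskMean_lower hM
  have hs0 : ∀ u, 0 ≤ (riskMean P T Z beta0 u)⁻¹ := fun u =>
    inv_nonneg.2 (integral_nonneg fun _ => (Real.exp_pos _).le)
  have hinv := tendstoUniformlyOn_comp_of_lipschitz (φ := fun a => a⁻¹)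
    (R.tendstoUniformlyOn_risk h h0 tendsto_id hb (isCompact_Icc (a := 0) (b := M))) hκ
    (fun v hv => hκle beta0 h0.le v hv.2)
    (fun a a' ha ha' => abs_inv_sub_inv_le (by positivity) ha ha')
  -- Stopping at M makes the functions monotone on the whole line with a continuous limit, as
  -- Pólya's theorem requires, and avoids times where S_{β₀} is not bounded below.
  set g : ℕ → ℝ → ℝ := fun n x => (∑ i ∈ Finset.range n with d i = true ∧ t i ≤ min x M,
    (riskMean P T Z beta0 (t i))⁻¹) / n with hg
  set A : ℝ → ℝ := fun x => ∫ ω in E ∩ {ω | T ω ≤ min x M}, (riskMean P T Z beta0 (T ω))⁻¹ ∂P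
    with hA
  have hAcont : Continuous A := by
    set φ : Ω → ℝ := (E ∩ {ω | T ω ≤ M}).indicator fun ω => (riskMean P T Z beta0 (T ω))⁻¹ with hφ
    have hS := h.measurableSet_E.inter (h.measurableSet_le M)
    have hmeas := (((h.continuous_riskMean h0.le).measurable.comp h.measurable_T).inv)
    have hφint : Integrable φ P := by
      refine (integrable_const κ⁻¹).mono' (hmeas.indicator hS).aestronglyMeasurable
        (ae_of_all _ fun ω => ?_)
      by_cases hω : ω ∈ E ∩ {ω | T ω ≤ M}
      · rw [hφ, indicator_of_mem hω, Real.norm_of_nonneg (hs0 _)]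
        exact inv_anti₀ hκ (hκle beta0 h0.le _ hω.2)
      · rw [hφ, indicator_of_notMem hω, norm_zero]
        exact (inv_pos.2 hκ).le
    have hc := (continuous_setIntegral_ge h.measurable_T h.ae_ne hφint).comp
      (continuous_id.min (continuous_const (y := M)))
    refine hc.congr fun x => ?_
    simp only [Function.comp_apply, id_eq, hA, hφ]
    rw [setIntegral_indicator hS]
    congr 2
    ext ω
    constructor
    · rintro ⟨a1, a2, _⟩; exact ⟨a2, a1⟩
    · rintro ⟨a1, a2⟩; exact ⟨a2, a1, le_trans (show T ω ≤ min x M from a2) (min_le_right _ _)⟩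
  have hganti : ∀ n, Antitone fun x => -g n x := by
    intro n x y hxy
    refine neg_le_neg (div_le_div_of_nonneg_right ?_ (Nat.cast_nonneg n))
    refine Finset.sum_le_sum_of_subset_of_nonneg (fun i hi => ?_) fun i _ _ => hs0 _
    rw [Finset.mem_filter] at hi ⊢
    exact ⟨hi.1, hi.2.1, hi.2.2.trans (min_le_min_right _ hxy)⟩
  have hgunif := tendstoUniformlyOn_of_antitone (F := atTop) (s := fun x => -A x) hganti
    hAcont.neg (fun q => (R.hazard q).neg) (isCompact_Icc (a := (0 : ℝ)) (b := M))
  rw [Metric.tendstoUniformlyOn_iff] at hgunif hinv ⊢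
  intro ε hε
  filter_upwards [hgunif (ε / 2) (by positivity), hinv (ε / 4) (by positivity)] with n h1 h2 x hx
  have a1 := h1 x hx
  have hAx : A x = m.real (Iic x) := by
    simp only [hA, min_eq_left hx.2]
    exact h.integral_inv_riskMean (hx.2.trans_lt hM)
  rw [Real.dist_eq, hAx] at a1
  rw [Real.dist_eq, breslow_eq_sum]
  -- The error of replacing the empirical weights by their limits is an average over at most n
  -- events of uniformly small terms.
  have a2 : |(∑ i ∈ Finset.range n with d i = true ∧ t i ≤ x,
      ((riskSum t z n (b n) (t i) / n)⁻¹ - (riskMean P T Z beta0 (t i))⁻¹)) / n| ≤ ε / 4 := by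
    refine abs_sum_div_le (Finset.filter_subset _ _) (by positivity) fun i hi => ?_
    have := h2 (t i) ⟨R.nonneg i, (Finset.mem_filter.1 hi).2.2.trans hx.2⟩
    rw [Real.dist_eq, abs_sub_comm] at this
    exact this.le
  have a3 : (∑ i ∈ Finset.range n with d i = true ∧ t i ≤ x,
      ((riskSum t z n (b n) (t i) / n)⁻¹ - (riskMean P T Z beta0 (t i))⁻¹)) / n =
      ∑ i ∈ Finset.range n with d i = true ∧ t i ≤ x, (riskSum t z n (b n) (t i))⁻¹ - g n x := by
    simp only [hg, min_eq_left hx.2]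
    rw [Finset.sum_sub_distrib, sub_div, Finset.sum_div]
    congr 1
    refine Finset.sum_congr rfl fun i hi => ?_
    have hn : (n : ℝ) ≠ 0 := by
      have : 0 < n := (Nat.zero_le i).trans_lt (Finset.mem_range.1 (Finset.mem_filter.1 hi).1)
      positivity
    rw [inv_div, div_div, mul_comm, ← div_div, div_self hn, one_div]
  rw [a3] at a2
  have b1 := abs_lt.1 a1
  have b2 := abs_le.1 a2
  rw [abs_lt]
  constructor <;> linarith [b1.1, b1.2, b2.1, b2.2]

end IsRegularSample

end

noncomputable section

variable {p : ℕ} {Ω Ω' : Type*} [MeasurableSpace Ω] [MeasurableSpace Ω'] {P : Measure Ω}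
  {Q : Measure Ω'} [IsProbabilityMeasure P] [IsProbabilityMeasure Q] {X C : Ω → ℝ}
  {Z : Ω → Cov p} {T : ℕ → Ω' → ℝ} {Δ : ℕ → Ω' → Bool} {Zs : ℕ → Ω' → Cov p} {m : Measure ℝ}
  {beta0 : Cov p} {ρ τ M : ℝ}

/-! ### Laws of large numbers for the sample -/

/-- The laws of large numbers are available off one null set only for countably many β; Lipschitz
bounds with convergent constants extend them to the whole ball on the same realization. -/
theorem tendsto_of_dense {D B : Set (Cov p)} (hDB : D ⊆ B) (hD : B ⊆ closure D)
    {f : ℕ → Cov p → ℝ} {s : Cov p → ℝ} {L : ℕ → ℝ} {l K : ℝ} (hL : Tendsto L atTop (𝓝 l))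
    (hf : ∀ n, ∀ β ∈ B, ∀ β' ∈ B, |f n β - f n β'| ≤ ‖β - β'‖ * L n)
    (hs : ∀ β ∈ B, ∀ β' ∈ B, |s β - s β'| ≤ ‖β - β'‖ * K)
    (h : ∀ β ∈ D, Tendsto (fun n => f n β) atTop (𝓝 (s β))) {β : Cov p} (hβ : β ∈ B) :
    Tendsto (fun n => f n β) atTop (𝓝 (s β)) := by
  rw [Metric.tendsto_nhds]
  intro ε hε
  have hc : 0 < |l| + |K| + 1 := by positivity
  obtain ⟨β', hβ', hd⟩ := Metric.mem_closure_iff.1 (hD hβ) (ε / 3 / (|l| + |K| + 1))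
    (by positivity)
  rw [dist_eq_norm, lt_div_iff₀ hc] at hd
  filter_upwards [Metric.tendsto_nhds.1 (h β' hβ') (ε / 3) (by positivity),
    Tendsto.eventually_lt_const (u := |l| + 1) (by linarith [le_abs_self l]) hL] with n h1 h2
  rw [Real.dist_eq] at h1 ⊢
  have h3 := hf n β hβ β' (hDB hβ')
  have h4 := hs β hβ β' (hDB hβ')
  have h5 : ‖β - β'‖ * L n ≤ ‖β - β'‖ * (|l| + |K| + 1) :=
    mul_le_mul_of_nonneg_left (by linarith [abs_nonneg K]) (norm_nonneg _)
  have h6 : ‖β - β'‖ * K ≤ ‖β - β'‖ * (|l| + |K| + 1) :=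
    mul_le_mul_of_nonneg_left (by linarith [abs_nonneg l, le_abs_self K]) (norm_nonneg _)
  have b1 := abs_lt.1 h1
  have b3 := abs_le.1 h3
  have b4 := abs_le.1 h4
  rw [abs_lt]
  constructor <;> linarith [b1.1, b1.2, b3.1, b3.2, b4.1, b4.2]

namespace IsCensoredSample

theorem ae_forall_mem (hS : IsCensoredSample Q T Δ Zs P X C Z) {B : Set (ℝ × Bool × Cov p)}
    (hB : MeasurableSet B)
    (h : ∀ᵐ ω ∂P, (min (X ω) (C ω), decide (X ω ≤ C ω), Z ω) ∈ B) :
    ∀ᵐ ω ∂Q, ∀ i, (T i ω, Δ i ω, Zs i ω) ∈ B :=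
  ae_all_iff.2 fun i => (hS.identDistrib i).symm.ae_snd hB h

/-- The strong law of large numbers for the sample. -/
theorem tendsto_average (hS : IsCensoredSample Q T Δ Zs P X C Z) {g : ℝ × Bool × Cov p → ℝ}
    (hg : Measurable g)
    (hint : Integrable (fun ω => g (min (X ω) (C ω), decide (X ω ≤ C ω), Z ω)) P) :
    ∀ᵐ ω ∂Q, Tendsto (fun n : ℕ => (∑ i ∈ Finset.range n, g (T i ω, Δ i ω, Zs i ω)) / n) atTop
      (𝓝 (∫ ω, g (min (X ω) (C ω), decide (X ω ≤ C ω), Z ω) ∂P)) := by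
  have hid : ∀ i, IdentDistrib (fun ω => g (T i ω, Δ i ω, Zs i ω))
      (fun ω => g (min (X ω) (C ω), decide (X ω ≤ C ω), Z ω)) Q P := fun i =>
    (hS.identDistrib i).comp hg
  have key := strong_law_ae_real (μ := Q) (fun i ω => g (T i ω, Δ i ω, Zs i ω))
    ((hid 0).integrable_iff.2 hint)
    (fun i j hij => (hS.indep.indepFun hij).comp hg hg)
    (fun i => (hid i).trans (hid 0).symm)
  rwa [(hid 0).integral_eq] at key

theorem tendsto_average_event (hS : IsCensoredSample Q T Δ Zs P X C Z)
    (hX : Measurable X) (hC : Measurable C) {φ : ℝ → Cov p → ℝ}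
    (hφ : Measurable fun r : ℝ × Cov p => φ r.1 r.2) {q : ℝ → Prop} [DecidablePred q]
    (hq : MeasurableSet {u | q u})
    (hint : IntegrableOn (fun ω => φ (min (X ω) (C ω)) (Z ω))
      ({ω | X ω ≤ C ω} ∩ {ω | q (min (X ω) (C ω))}) P) :
    ∀ᵐ ω ∂Q, Tendsto (fun n : ℕ => (∑ i ∈ Finset.range n with Δ i ω = true ∧ q (T i ω),
      φ (T i ω) (Zs i ω)) / n) atTop
      (𝓝 (∫ ω in {ω | X ω ≤ C ω} ∩ {ω | q (min (X ω) (C ω))},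
        φ (min (X ω) (C ω)) (Z ω) ∂P)) := by
  have hmS : MeasurableSet ({ω | X ω ≤ C ω} ∩ {ω | q (min (X ω) (C ω))}) :=
    (measurableSet_le hX hC).inter ((hX.min hC) hq)
  have hset : MeasurableSet {r : ℝ × Bool × Cov p | r.2.1 = true ∧ q r.1} :=
    ((measurable_fst.comp measurable_snd) (measurableSet_singleton true)).inter
      (measurable_fst hq)
  have hg : Measurable fun r : ℝ × Bool × Cov p =>
      if r.2.1 = true ∧ q r.1 then φ r.1 r.2.2 else 0 :=
    Measurable.ite hset (hφ.comp (f := fun r : ℝ × Bool × Cov p => (r.1, r.2.2)) (by fun_prop))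
      measurable_const
  have e : ∀ ω, (if decide (X ω ≤ C ω) = true ∧ q (min (X ω) (C ω)) then
      φ (min (X ω) (C ω)) (Z ω) else 0) =
      ({ω | X ω ≤ C ω} ∩ {ω | q (min (X ω) (C ω))}).indicator
        (fun ω => φ (min (X ω) (C ω)) (Z ω)) ω := by
    intro ω
    by_cases h1 : X ω ≤ C ω <;> by_cases h2 : q (min (X ω) (C ω)) <;>
      simp only [indicator, mem_inter_iff, mem_ofPred_eq, h1, h2, decide_true, decide_false,
        and_true, and_false, if_true, if_false, Bool.false_eq_true, and_self]
  have key := hS.tendsto_average hg (by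
    simp only [e]
    exact (integrable_indicator_iff hmS).2 hint)
  simp only [e] at key
  rw [integral_indicator hmS] at key
  simpa only [Finset.sum_filter] using key

theorem tendsto_average_risk (hS : IsCensoredSample Q T Δ Zs P X C Z)
    (hX : Measurable X) (hC : Measurable C) {β : Cov p} (u : ℝ)
    (hint : Integrable (fun ω => Real.exp (inner ℝ β (Z ω))) P) :
    ∀ᵐ ω ∂Q, Tendsto (fun n : ℕ => riskSum (fun i => T i ω) (fun i => Zs i ω) n β u / n) atTop
      (𝓝 (riskMean P (fun ω => min (X ω) (C ω)) Z β u)) := by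
  have hmS : MeasurableSet {ω | u ≤ min (X ω) (C ω)} :=
    measurableSet_le measurable_const (hX.min hC)
  have hg : Measurable fun r : ℝ × Bool × Cov p =>
      if u ≤ r.1 then Real.exp (inner ℝ β r.2.2) else 0 :=
    Measurable.ite (measurableSet_le measurable_const measurable_fst) (by fun_prop)
      measurable_const
  have e : ∀ ω, (if u ≤ min (X ω) (C ω) then Real.exp (inner ℝ β (Z ω)) else 0) =
      {ω | u ≤ min (X ω) (C ω)}.indicator (fun ω => Real.exp (inner ℝ β (Z ω))) ω :=
    fun ω => rfl
  have key := hS.tendsto_average hg (by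
    simp only [e]
    exact hint.indicator hmS)
  simp only [e] at key
  rw [integral_indicator hmS] at key
  simpa only [riskSum, riskMean, Finset.sum_filter] using key

end IsCensoredSample

/-- Each null direction comes with its own exceptional set, but finitely many of them span, so a
single null set suffices. -/
theorem ae_mem_orthogonal_nullDirections {T : Ω → ℝ} :
    ∀ᵐ ω ∂P, m (Iic (T ω)) ≠ 0 → Z ω ∈ (nullDirections P T Z m)ᗮ := by
  obtain ⟨S, hS⟩ := (IsNoetherian.noetherian (nullDirections P T Z m) :
    (nullDirections P T Z m).FG)
  have h : ∀ᵐ ω ∂P, ∀ c ∈ S, m (Iic (T ω)) ≠ 0 → inner ℝ c (Z ω) = (0 : ℝ) := by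
    refine (ae_ball_iff S.countable_toSet).2 fun c hc => ?_
    have : c ∈ nullDirections P T Z m := hS ▸ Submodule.subset_span hc
    exact this
  filter_upwards [h] with ω hω hpos
  rw [Submodule.mem_orthogonal]
  intro c hc
  rw [← hS] at hc
  induction hc using Submodule.span_induction with
  | mem c hc => exact hω c hc hpos
  | zero => exact inner_zero_left _
  | add a b _ _ ha hb => rw [inner_add_left, ha, hb, add_zero]
  | smul k a _ ha => rw [inner_smul_left, ha, mul_zero]

theorem EventModel.abs_logRatio_sub_le {T : Ω → ℝ} {E : Set Ω}
    (h : EventModel P T E Z m beta0 ρ τ) {κ : ℝ} (hκ : 0 < κ) {u : ℝ}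
    (hle : ∀ β, ‖β - beta0‖ ≤ ρ → κ ≤ riskMean P T Z β u) {β β' : Cov p}
    (hβ : ‖β - beta0‖ ≤ ρ) (hβ' : ‖β' - beta0‖ ≤ ρ) (z : Cov p) :
    |logRatio P T Z beta0 β u z - logRatio P T Z beta0 β' u z| ≤
      ‖β - β'‖ * ((1 + ‖z‖) + κ⁻¹ * ∫ ω, envelope beta0 ρ (Z ω) ∂P) := by
  have e : logRatio P T Z beta0 β u z - logRatio P T Z beta0 β' u z =
      inner ℝ (β - β') z -
        (Real.log (riskMean P T Z β u) - Real.log (riskMean P T Z β' u)) := by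
    simp only [logRatio, inner_sub_left]; ring
  have h1 := abs_log_sub_log_le hκ (hle β hβ) (hle β' hβ')
  have h2 := mul_le_mul_of_nonneg_left (h.abs_riskMean_sub_le hβ hβ' u) (inv_pos.2 hκ).le
  have h3 := abs_real_inner_le_norm (β - β') z
  rw [e]
  refine (abs_sub _ _).trans ?_
  linarith [norm_nonneg (β - β')]

/-- Almost every realization of the sample is regular. -/
theorem IsCensoredSample.ae_isRegularSample [IsFiniteMeasure m]
    (hS : IsCensoredSample Q T Δ Zs P X C Z) (hX : Measurable X) (hC : Measurable C)
    (h : EventModel P (fun ω => min (X ω) (C ω)) {ω | X ω ≤ C ω} Z m beta0 ρ τ) (hM : M < τ) :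
    ∀ᵐ ω ∂Q, IsRegularSample P (fun ω => min (X ω) (C ω)) {ω | X ω ≤ C ω} Z m beta0 ρ τ M
      (fun i => T i ω) (fun i => Δ i ω) (fun i => Zs i ω) := by
  have hZ := h.measurable_Z
  have h0 : ‖beta0 - beta0‖ ≤ ρ := by simpa using h.rho_pos.le
  obtain ⟨D, hDB, hDc, hD⟩ := (TopologicalSpace.IsSeparable.of_separableSpace
    (Metric.closedBall beta0 ρ)).exists_countable_dense_subset
  have hball : ∀ β, β ∈ Metric.closedBall beta0 ρ ↔ ‖β - beta0‖ ≤ ρ := fun β =>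
    mem_closedBall_iff_norm
  have aenv : ∀ᵐ ω ∂Q, Tendsto (fun n : ℕ => (∑ i ∈ Finset.range n,
      envelope beta0 ρ (Zs i ω)) / n) atTop (𝓝 (∫ ω, envelope beta0 ρ (Z ω) ∂P)) :=
    hS.tendsto_average (g := fun r => envelope beta0 ρ r.2.2)
      ((measurable_envelope _ _).comp (by fun_prop)) h.integrable_envelope
  have anorm : ∀ᵐ ω ∂Q, Tendsto (fun n : ℕ => (∑ i ∈ Finset.range n with Δ i ω = true,
      (1 + ‖Zs i ω‖)) / n) atTop (𝓝 (∫ ω in {ω | X ω ≤ C ω}, (1 + ‖Z ω‖) ∂P)) := by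
    have := hS.tendsto_average_event hX hC (φ := fun _ z => 1 + ‖z‖) (q := fun _ => True)
      (by fun_prop) (by simp) (h.integrableOn_norm.mono_set inter_subset_left)
    simpa using this
  have atenv : ∀ᵐ ω ∂Q, ∀ k, Tendsto (fun n : ℕ => (∑ i ∈ Finset.range n with
      Δ i ω = true ∧ threshold τ k < T i ω, envelope beta0 ρ (Zs i ω)) / n) atTop
      (𝓝 (∫ ω in {ω | X ω ≤ C ω} ∩ {ω | threshold τ k < min (X ω) (C ω)},
        envelope beta0 ρ (Z ω) ∂P)) :=
    ae_all_iff.2 fun k => hS.tendsto_average_event hX hC (φ := fun _ z => envelope beta0 ρ z)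
      (q := fun u => threshold τ k < u) ((measurable_envelope _ _).comp measurable_snd)
      measurableSet_Ioi h.integrable_envelope.integrableOn
  have atnorm : ∀ᵐ ω ∂Q, ∀ k, Tendsto (fun n : ℕ => (∑ i ∈ Finset.range n with
      Δ i ω = true ∧ threshold τ k < T i ω, (1 + ‖Zs i ω‖)) / n) atTop
      (𝓝 (∫ ω in {ω | X ω ≤ C ω} ∩ {ω | threshold τ k < min (X ω) (C ω)},
        (1 + ‖Z ω‖) ∂P)) :=
    ae_all_iff.2 fun k => hS.tendsto_average_event hX hC (φ := fun _ z => 1 + ‖z‖)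
      (q := fun u => threshold τ k < u) (by fun_prop)
      measurableSet_Ioi (h.integrableOn_norm.mono_set inter_subset_left)
  have arisk : ∀ᵐ ω ∂Q, ∀ β ∈ D, ∀ q : ℚ, Tendsto (fun n : ℕ =>
      riskSum (fun i => T i ω) (fun i => Zs i ω) n β q / n) atTop
      (𝓝 (riskMean P (fun ω => min (X ω) (C ω)) Z β q)) :=
    (ae_ball_iff hDc).2 fun β hβ => ae_all_iff.2 fun q =>
      hS.tendsto_average_risk hX hC q (h.integrable_exp ((hball β).1 (hDB hβ)))
  have hmeasR : ∀ β, ‖β - beta0‖ ≤ ρ → Measurable fun r : ℝ × Cov p =>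
      EventModel.logRatio P (fun ω => min (X ω) (C ω)) Z beta0 β r.1 r.2 := by
    intro β hβ
    have h1 := (h.continuous_riskMean hβ).measurable
    have h2 := (h.continuous_riskMean h0).measurable
    unfold EventModel.logRatio
    fun_prop
  have aratio : ∀ᵐ ω ∂Q, ∀ β ∈ D, ∀ k, Tendsto (fun n : ℕ => (∑ i ∈ Finset.range n with
      Δ i ω = true ∧ T i ω ≤ threshold τ k, EventModel.logRatio P (fun ω => min (X ω) (C ω)) Z
        beta0 β (T i ω) (Zs i ω)) / n) atTop
      (𝓝 (∫ ω in {ω | X ω ≤ C ω} ∩ {ω | min (X ω) (C ω) ≤ threshold τ k},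
        EventModel.logRatio P (fun ω => min (X ω) (C ω)) Z beta0 β
          (min (X ω) (C ω)) (Z ω) ∂P)) :=
    (ae_ball_iff hDc).2 fun β hβ => ae_all_iff.2 fun k =>
      hS.tendsto_average_event hX hC
        (φ := fun u z => EventModel.logRatio P (fun ω => min (X ω) (C ω)) Z beta0 β u z)
        (q := fun u => u ≤ threshold τ k) (hmeasR β ((hball β).1 (hDB hβ))) measurableSet_Iic
        (h.integrableOn_logRatio ((hball β).1 (hDB hβ)) (threshold_lt τ k))
  obtain ⟨κM, hκM, hκMle⟩ := h.exists_riskMean_lower hM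
  have hsm := ((h.continuous_riskMean h0).measurable).inv
  have ahaz : ∀ᵐ ω ∂Q, ∀ q : ℚ, Tendsto (fun n : ℕ => (∑ i ∈ Finset.range n with
      Δ i ω = true ∧ T i ω ≤ min (q : ℝ) M,
        (riskMean P (fun ω => min (X ω) (C ω)) Z beta0 (T i ω))⁻¹) / n) atTop
      (𝓝 (∫ ω in {ω | X ω ≤ C ω} ∩ {ω | min (X ω) (C ω) ≤ min (q : ℝ) M},
        (riskMean P (fun ω => min (X ω) (C ω)) Z beta0 (min (X ω) (C ω)))⁻¹ ∂P)) := by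
    refine ae_all_iff.2 fun q => hS.tendsto_average_event hX hC
      (φ := fun u _ => (riskMean P (fun ω => min (X ω) (C ω)) Z beta0 u)⁻¹)
      (q := fun u => u ≤ min (q : ℝ) M) (hsm.comp measurable_fst) measurableSet_Iic ?_
    refine (integrable_const κM⁻¹).mono' (hsm.comp h.measurable_T).aestronglyMeasurable ?_
    filter_upwards [ae_restrict_mem (h.measurableSet_E.inter (h.measurableSet_le _))] with ω hω
    have hωM : min (X ω) (C ω) ≤ M := le_trans hω.2 (min_le_right _ _)
    have := hκMle beta0 h0 _ hωM
    rw [Real.norm_of_nonneg (inv_nonneg.2 (hκM.le.trans this))]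
    exact inv_anti₀ hκM this
  have hmm : Measurable fun u => m (Iic u) :=
    Monotone.measurable fun a b hab => measure_mono (Iic_subset_Iic.2 hab)
  have hpos : MeasurableSet {u : ℝ | m (Iic u) ≠ 0} := hmm (measurableSet_singleton 0).compl
  have ann : ∀ᵐ ω ∂Q, ∀ i, (T i ω, Δ i ω, Zs i ω) ∈ {r : ℝ × Bool × Cov p | 0 ≤ r.1} :=
    hS.ae_forall_mem (measurableSet_le measurable_const measurable_fst) h.ae_nonneg
  have aev : ∀ᵐ ω ∂Q, ∀ i, (T i ω, Δ i ω, Zs i ω) ∈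
      {r : ℝ × Bool × Cov p | r.2.1 = true → m (Iic r.1) ≠ 0} :=
    hS.ae_forall_mem (MeasurableSet.imp
      ((measurable_fst.comp measurable_snd) (measurableSet_singleton true))
      (measurable_fst hpos)) (by
        filter_upwards [h.ae_event_measure_ne_zero] with ω hω hE
        exact hω (of_decide_eq_true hE))
  have aorth : ∀ᵐ ω ∂Q, ∀ i, (T i ω, Δ i ω, Zs i ω) ∈ {r : ℝ × Bool × Cov p |
      m (Iic r.1) ≠ 0 → r.2.2 ∈ (nullDirections P (fun ω => min (X ω) (C ω)) Z m)ᗮ} :=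
    hS.ae_forall_mem (MeasurableSet.imp (measurable_fst hpos)
      ((measurable_snd.comp measurable_snd) (Submodule.closed_of_finiteDimensional
        (nullDirections P (fun ω => min (X ω) (C ω)) Z m)ᗮ).measurableSet))
      ae_mem_orthogonal_nullDirections
  filter_upwards [aenv, anorm, atenv, atnorm, arisk, aratio, ahaz, ann, aev, aorth] with ω
    henv hnorm htenv htnorm hrisk hratio hhaz hnn hev horth
  refine ⟨hnn, ?_, henv, hnorm, htenv, htnorm, ?_, hhaz, ?_⟩
  · intro β hβ q
    refine tendsto_of_dense hDB hD henv
      (f := fun n β => riskSum (fun i => T i ω) (fun i => Zs i ω) n β q / n)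
      (s := fun β => riskMean P (fun ω => min (X ω) (C ω)) Z β q)
      (fun n b hb b' hb' => abs_riskSum_sub_le ((hball b).1 hb) ((hball b').1 hb') n _)
      (fun b hb b' hb' => h.abs_riskMean_sub_le ((hball b).1 hb) ((hball b').1 hb') _)
      (fun b hb => hrisk b hb q) ((hball β).2 hβ)
  · intro k β hβ
    obtain ⟨κ, hκ, hκle⟩ := h.exists_riskMean_lower (threshold_lt τ k)
    set c := κ⁻¹ * ∫ ω, envelope beta0 ρ (Z ω) ∂P with hc
    have hc0 : 0 ≤ c := mul_nonneg (inv_pos.2 hκ).le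
      (integral_nonneg fun ω => (envelope_pos _ _ _).le)
    refine tendsto_of_dense hDB hD (hnorm.add_const c)
      (f := fun n β => (∑ i ∈ Finset.range n with Δ i ω = true ∧ T i ω ≤ threshold τ k,
        EventModel.logRatio P (fun ω => min (X ω) (C ω)) Z beta0 β (T i ω) (Zs i ω)) / n)
      (s := fun β => ∫ ω in {ω | X ω ≤ C ω} ∩ {ω | min (X ω) (C ω) ≤ threshold τ k},
        EventModel.logRatio P (fun ω => min (X ω) (C ω)) Z beta0 β
          (min (X ω) (C ω)) (Z ω) ∂P)
      (K := ∫ ω in {ω | X ω ≤ C ω} ∩ {ω | min (X ω) (C ω) ≤ threshold τ k},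
        ((1 + ‖Z ω‖) + c) ∂P)
      ?_ ?_ (fun b hb => hratio b hb k) ((hball β).2 hβ)
    · intro n b hb b' hb'
      rcases Nat.eq_zero_or_pos n with rfl | hn0
      · simpa using mul_nonneg (norm_nonneg (b - b')) hc0
      have hn : (0 : ℝ) < n := by exact_mod_cast hn0
      rw [← sub_div, ← Finset.sum_sub_distrib, abs_div, Nat.abs_cast, div_le_iff₀ hn]
      refine (Finset.abs_sum_le_sum_abs _ _).trans ((Finset.sum_le_sum fun i hi =>
        h.abs_logRatio_sub_le hκ (fun β hβ => hκle β hβ _ (Finset.mem_filter.1 hi).2.2)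
          ((hball b).1 hb) ((hball b').1 hb') (Zs i ω)).trans ?_)
      rw [← Finset.mul_sum, mul_assoc, add_mul, div_mul_cancel₀ _ hn.ne', Finset.sum_add_distrib]
      refine mul_le_mul_of_nonneg_left (add_le_add ?_ ?_) (norm_nonneg _)
      · refine Finset.sum_le_sum_of_subset_of_nonneg (fun j hj => ?_) fun j _ _ => by positivity
        rw [Finset.mem_filter] at hj ⊢
        exact ⟨hj.1, hj.2.1⟩
      · rw [Finset.sum_const, nsmul_eq_mul, mul_comm]
        refine mul_le_mul_of_nonneg_left ?_ hc0
        exact_mod_cast (Finset.card_filter_le _ _).trans (Finset.card_range n).le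
    · intro b hb b' hb'
      have hi1 := h.integrableOn_logRatio ((hball b).1 hb) (threshold_lt τ k)
      have hi2 := h.integrableOn_logRatio ((hball b').1 hb') (threshold_lt τ k)
      rw [← integral_sub hi1 hi2, ← integral_const_mul, ← Real.norm_eq_abs]
      refine norm_integral_le_of_norm_le (((h.integrableOn_norm.mono_set
        inter_subset_left).add (integrable_const c)).const_mul _) ?_
      filter_upwards [ae_restrict_mem (h.measurableSet_E.inter (h.measurableSet_le _))] with x hx
      exact h.abs_logRatio_sub_le hκ (fun β hβ => hκle β hβ _ hx.2)
          ((hball b).1 hb) ((hball b').1 hb') (Z x)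
  · intro c hc i j hi hij
    have hi0 : m (Iic (T i ω)) ≠ 0 := hev i hi
    -- Anyone at risk at an event time has been observed at least that long, so the hazard mass up
    -- to its own time is positive, too.
    have hj0 : m (Iic (T j ω)) ≠ 0 := fun h0 =>
      hi0 (measure_mono_null (Iic_subset_Iic.2 hij) h0)
    exact (Submodule.mem_orthogonal _ _).1 (horth j hj0) c hc

end

noncomputable section

variable {p : ℕ} {Ω : Type*} [MeasurableSpace Ω] {P : Measure Ω} [IsProbabilityMeasure P]
  {X C : Ω → ℝ} {Z : Ω → Cov p} {lam0 : ℝ → ℝ} {beta0 : Cov p}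

/-! ### The baseline distribution function -/

theorem hazardMeasure_real_Iic (hlam : Measurable lam0) (hnn : ∀ x, 0 ≤ x → 0 ≤ lam0 x) {x : ℝ}
    (hx : 0 ≤ x) : (hazardMeasure lam0).real (Iic x) = baseCumHazard lam0 x := by
  rw [baseCumHazard, intervalIntegral.integral_of_le hx, ← integral_Icc_eq_integral_Ioc,
    integral_eq_lintegral_of_nonneg_ae _ hlam.aestronglyMeasurable, Measure.real, hazardMeasure,
    withDensity_apply _ measurableSet_Iic, Measure.restrict_restrict measurableSet_Iic,
    Iic_inter_Ici]
  filter_upwards [ae_restrict_mem measurableSet_Icc] with u hu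
  exact hnn u hu.1

theorem abs_exp_neg_sub_exp_neg_le {a b : ℝ} (ha : 0 ≤ a) (hb : 0 ≤ b) :
    |Real.exp (-a) - Real.exp (-b)| ≤ |a - b| := by
  refine (abs_exp_sub_exp_le _ _).trans ?_
  rw [neg_sub_neg, abs_sub_comm]
  refine mul_le_of_le_one_right (abs_nonneg _) (max_le ?_ ?_) <;>
    exact Real.exp_le_one_iff.2 (by linarith)

theorem tendsto_iSup_baseCDFEst {t : ℕ → ℝ} {d : ℕ → Bool} {z : ℕ → Cov p} {b : ℕ → Cov p}
    {M : ℝ} (hM : 0 ≤ M) (hnn : ∀ x, 0 ≤ x → 0 ≤ lam0 x)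
    (h : TendstoUniformlyOn (fun n x => breslow t d z n (b n) x) (baseCumHazard lam0) atTop
      (Icc 0 M)) :
    Tendsto (fun n : ℕ => ⨆ x : Icc (0 : ℝ) M,
      |baseCDFEst t d z n (b n) x - baseCDF lam0 x|) atTop (𝓝 0) := by
  have hne : Nonempty (Icc (0 : ℝ) M) := ⟨⟨0, le_rfl, hM⟩⟩
  rw [Metric.tendsto_nhds]
  intro ε hε
  filter_upwards [Metric.tendstoUniformlyOn_iff.1 h (ε / 2) (by positivity)] with n hn
  have hle : ∀ x : Icc (0 : ℝ) M, |baseCDFEst t d z n (b n) x - baseCDF lam0 x| ≤ ε / 2 := by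
    intro x
    have hΛ : 0 ≤ baseCumHazard lam0 x :=
      intervalIntegral.integral_nonneg x.2.1 fun u hu => hnn u hu.1
    have h1 := abs_exp_neg_sub_exp_neg_le hΛ (breslow_nonneg t d z n (b n) x)
    have h2 := hn x x.2
    rw [Real.dist_eq] at h2
    rw [baseCDFEst, baseCDF, sub_sub_sub_cancel_left]
    exact h1.trans h2.le
  have h0 : 0 ≤ ⨆ x : Icc (0 : ℝ) M, |baseCDFEst t d z n (b n) x - baseCDF lam0 x| :=
    Real.iSup_nonneg fun x => abs_nonneg _
  rw [Real.dist_eq, sub_zero, abs_of_nonneg h0]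
  exact (ciSup_le hle).trans_lt (half_lt_self hε)

end

end CoxBreslow

theorem corollary4p4 {p : ℕ} {Ω Ω' : Type*} [MeasurableSpace Ω] [MeasurableSpace Ω']
    (P : Measure Ω) [IsProbabilityMeasure P] (Q : Measure Ω') [IsProbabilityMeasure Q]
    (X C : Ω → ℝ) (Z : Ω → CoxBreslow.Cov p) (lam0 : ℝ → ℝ) (beta0 : CoxBreslow.Cov p)
    (hCox : CoxBreslow.IsCoxModel P X C Z lam0 beta0)
    (hA1 : CoxBreslow.EndPointCondition P X C)
    (hA2 : CoxBreslow.MomentCondition P Z beta0)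
    (hId : CoxBreslow.BaselineIdentifiable P X C Z)
    (T : ℕ → Ω' → ℝ) (Δ : ℕ → Ω' → Bool) (Zs : ℕ → Ω' → CoxBreslow.Cov p)
    (hSample : CoxBreslow.IsCensoredSample Q T Δ Zs P X C Z)
    (betaHat : ℕ → Ω' → CoxBreslow.Cov p)
    (hMPLE : CoxBreslow.IsMPLE Q T Δ Zs betaHat)
    (M : ℝ) (hM0 : 0 < M)
    (hM : (M : EReal) < CoxBreslow.supportEnd (P.map (fun ω => min (X ω) (C ω)))) :
    ∀ᵐ ω ∂Q, Tendsto
      (fun n : ℕ => ⨆ x : Icc (0 : ℝ) M,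
        |CoxBreslow.baseCDFEst (fun i => T i ω) (fun i => Δ i ω) (fun i => Zs i ω) n
            (betaHat n ω) x - CoxBreslow.baseCDF lam0 x|)
      atTop (𝓝 0) := by
  obtain ⟨y, ρ, τ, hMτ, hτy, hfin, h⟩ := hCox.exists_eventModel hA1 hA2 hM
  have hfinm : IsFiniteMeasure ((CoxBreslow.hazardMeasure lam0).restrict (Iic y)) :=
    isFiniteMeasure_restrict.2 hfin.ne
  filter_upwards [hSample.ae_isRegularSample hCox.measurable_X hCox.measurable_C h hMτ,
    ae_all_iff.2 hMPLE] with ω R hmax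
  have hunif := R.tendstoUniformlyOn_breslow h hMτ (R.tendsto_normalize h hId hmax)
  refine CoxBreslow.tendsto_iSup_baseCDFEst hM0.le hCox.lam0_nonneg ?_
  refine (hunif.congr (Eventually.of_forall fun n x _ => ?_)).congr_right fun x hx => ?_
  -- The estimator itself need not converge; only its component off the null directions does, and
  -- the Breslow estimator is the same for both.
  · have e := CoxBreslow.breslow_congr_of_inner_eq
      (R.inner_normalize (betaHat n ω - beta0)) n x
    rw [add_sub_cancel] at e
    exact e.symm
  · beta_reduce
    -- Restricting the hazard measure to `Iic y` is harmless here because x ≤ M < τ ≤ y.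
    rw [← CoxBreslow.hazardMeasure_real_Iic hCox.measurable_lam0 hCox.lam0_nonneg hx.1,
      measureReal_restrict_apply measurableSet_Iic, Iic_inter_Iic,
      min_eq_left (hx.2.trans (hMτ.le.trans hτy))]
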